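/- All Hilbert spaces are complex, and an unbounded operator $T$ on $\mathcal H$ is a linear map $T:\mathrm{dom}(T)\to\mathcal H$ defined on a linear subspace of $\mathcal H$; equality of operators includes equality of domains. For $A,B\in\mathcal B(\mathcal H)$ with $\mathrm{null}(B)\subseteq\mathrm{null}(A)$, let $A/B$ be the operator with domain $\mathrm{ran}(B)$ given by $Bx\mapsto Ax$. For a von Neumann algebra $\mathscr M$ acting on $\mathcal H$, put $$\mathscr M_{\mathrm{aff}}=\{A/B : A,B\in\mathscr M,\ \mathrm{null}(B)\subseteq\mathrm{null}(A)\}.$$ If $\Phi:\mathscr M\to\mathscr N$ is a unital normal $*$-homomorphism into a von Neumann algebra $\mathscr N$ acting on $\mathcal K$, let $\Phi_{\mathrm{aff}}:\mathscr M_{\mathrm{aff}}\to\mathscr N_{\mathrm{aff}}$ be the (well-defined) map $A/B\mapsto\Phi(A)/\Phi(B)$. An operator $T$ is positive if $\langle Tx,x\rangle\ge 0$ for all $x\in\mathrm{dom}(T)$. Let $S$ be a densely defined positive operator. Its Friedrichs extension $S_F$ is the restriction of $S^*$ to the set of those $x\in\mathrm{dom}(S^*)$ for which there is a sequence $(x_n)$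 in $\mathrm{dom}(S)$ with $x_n\to x$ and $\langle S(x_n-x_m),x_n-x_m\rangle\to0$ as $m,n\to\infty$. Its Krein–von Neumann extension $S_K$ is the smallest positive self-adjoint extension of $S$, in the order of positive self-adjoint operators in which $T\le T'$ means $(T'+I)^{-1}\le(T+I)^{-1}$. **Theorem.** Let $\mathscr M$ and $\mathscr N$ be von Neumann algebras acting on Hilbert spaces $\mathcal H$ and $\mathcal K$, let $\Phi:\mathscr M\to\mathscr N$ be a unital normal $*$-homomorphism, and let $S\in\mathscr M_{\mathrm{aff}}$ be densely defined, closed and positive. Then $\Phi_{\mathrm{aff}}(S)\in\mathscr N_{\mathrm{aff}}$ is densely defined, closed and positive. The operators $S_K$ and $S_F$ exist, are positive self-adjoint extensions of $S$, and belong to $\mathscr M_{\mathrm{aff}}$; likewise $\Phi_{\mathrm{aff}}(S)_K$ and $\Phi_{\mathrm{aff}}(S)_F$ exist and are positive self-adjoint extensions of $\Phi_{\mathrm{aff}}(S)$. Moreover $$\Phi_{\mathrm{aff}}(S_K)=\bigl(\Phi_{\mathrm{aff}}(S)\bigr)_K\qquad\text{and}\qquad \Phi_{\mathrm{aff}}(S_F)=\bigl(\Phi_{\mathrm{aff}}(S)\bigr)_F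 .$$ -/

import Mathlib

noncomputable section

set_option linter.unusedSectionVars false

open Filter Topology

namespace AffiliatedOperators

universe u v

variable {H : Type u} [NormedAddCommGroup H] [InnerProductSpace ℂ H] [CompleteSpace H]
variable {K : Type v} [NormedAddCommGroup K] [InnerProductSpace ℂ K] [CompleteSpace K]

/-! ### Quotients of bounded operators and affiliated operators -/

/-- The quotient `A/B` of bounded operators with `null B ⊆ null A`: the unbounded operator with
domain `ran B` that sends `B u` to `A u`. It is given through its graph `{(B u, A u) : u ∈ H}`
(see `mem_graph_quotient`), and is used only under the condition `null B ⊆ null A`. -/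
def quotient (A B : H →L[ℂ] H) : H →ₗ.[ℂ] H :=
  (LinearMap.range ((B.prod A : H →L[ℂ] H × H) : H →ₗ[ℂ] H × H)).toLinearPMap

theorem mem_graph_quotient {A B : H →L[ℂ] H} (h : ∀ x, B x = 0 → A x = 0) (p : H × H) :
    p ∈ (quotient A B).graph ↔ ∃ u, B u = p.1 ∧ A u = p.2 := by
  rw [quotient, Submodule.toLinearPMap_graph_eq]
  · obtain ⟨x, y⟩ := p
    simp
  · rintro ⟨x, y⟩ ⟨u, hu⟩ hx
    simp only [ContinuousLinearMap.coe_coe, ContinuousLinearMap.prod_apply,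
      Prod.mk.injEq] at hu hx ⊢
    rw [← hu.2]
    exact h u (hu.1.trans hx)

/-- The set `M_aff` of operators affiliated with a represented von Neumann algebra `(M; H)`:
all quotients `A/B` with `A, B ∈ M` and `null B ⊆ null A`. -/
def affiliated (M : VonNeumannAlgebra H) : Set (H →ₗ.[ℂ] H) :=
  {T | ∃ A ∈ M, ∃ B ∈ M, (∀ x, B x = 0 → A x = 0) ∧ T = quotient A B}

/-! ### Normal homomorphisms -/

/-- A unital `*`-homomorphism between von Neumann algebras is normal if it preserves the least
upper bound of every increasing net (equivalently, every nonempty upward directed set) of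
self-adjoint elements that has one. The order is the order of bounded operators. -/
def IsNormalHom {M : VonNeumannAlgebra H} {N : VonNeumannAlgebra K}
    (Φ : M.toStarSubalgebra →⋆ₐ[ℂ] N.toStarSubalgebra) : Prop :=
  ∀ (D : Set M.toStarSubalgebra) (a : M.toStarSubalgebra), D.Nonempty →
    (∀ d ∈ D, IsSelfAdjoint d) → DirectedOn (· ≤ ·) D → IsLUB D a → IsLUB (Φ '' D) (Φ a)

/-! ### The extension of a normal homomorphism to affiliated operators -/

open Classical in
/-- The map `Φ_aff : M_aff → N_aff`, `A/B ↦ Φ(A)/Φ(B)`. For normal `Φ` the value does not depend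
on the representation of the operator as a quotient, and lies in `N_aff`; see `affMap_quotient`
and `affMap_mem_affiliated`. (Outside `M_aff` the value is irrelevant.) -/
def affMap {M : VonNeumannAlgebra H} {N : VonNeumannAlgebra K}
    (Φ : M.toStarSubalgebra →⋆ₐ[ℂ] N.toStarSubalgebra) (T : H →ₗ.[ℂ] H) : K →ₗ.[ℂ] K :=
  if h : ∃ q : M.toStarSubalgebra × M.toStarSubalgebra,
      (∀ x, (q.2 : H →L[ℂ] H) x = 0 → (q.1 : H →L[ℂ] H) x = 0) ∧
        T = quotient (q.1 : H →L[ℂ] H) (q.2 : H →L[ℂ] H) then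
    quotient (Φ h.choose.1 : K →L[ℂ] K) (Φ h.choose.2 : K →L[ℂ] K)
  else ⊥

/-- The null projection of an operator in `M` lies in `M`. -/
theorem nullProj_mem (M : VonNeumannAlgebra H) {B : H →L[ℂ] H} (hB : B ∈ M) :
    (LinearMap.ker (B : H →ₗ[ℂ] H)).starProjection ∈ M := by
  rw [VonNeumannAlgebra.IsStarProjection.mem_iff isStarProjection_starProjection]
  intro y hy
  rw [Submodule.range_starProjection, Module.End.mem_invtSubmodule]
  intro x hx
  have h := congrArg (fun T : H →L[ℂ] H => T x) (VonNeumannAlgebra.mem_commutant_iff.1 hy B hB)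
  have hx' : B x = 0 := hx
  change B (y x) = 0
  simpa [hx'] using h

section NullProjection

variable (B : H →L[ℂ] H) (c : ℝ)

/-- The operator `I - c B* B`. -/
def approx : H →L[ℂ] H := 1 - (c : ℂ) • (star B * B)

theorem approx_nonneg (hc0 : 0 ≤ c) (hc : c * ‖B‖ ^ 2 ≤ 1) : 0 ≤ approx B c := by
  rw [ContinuousLinearMap.nonneg_iff_isPositive, ContinuousLinearMap.isPositive_def']
  constructor
  · simp [approx, IsSelfAdjoint, star_sub, star_smul, star_mul]
  · intro x
    have h : ‖B x‖ ^ 2 ≤ ‖B‖ ^ 2 * ‖x‖ ^ 2 := by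
      rw [← mul_pow]
      exact pow_le_pow_left₀ (norm_nonneg _) (B.le_opNorm x) 2
    have e : (approx B c).reApplyInnerSelf x = ‖x‖ ^ 2 - c * ‖B x‖ ^ 2 := by
      simp only [approx, ContinuousLinearMap.reApplyInnerSelf_apply, sub_apply,
        one_apply_eq_self, smul_apply,
        mul_apply_eq_comp, ContinuousLinearMap.star_eq_adjoint, inner_sub_left,
        inner_smul_left, ContinuousLinearMap.adjoint_inner_left, inner_self_eq_norm_sq_to_K,
        Complex.conj_ofReal]
      simp [← Complex.ofReal_pow]
    rw [e]
    nlinarith [sq_nonneg ‖x‖, mul_le_mul_of_nonneg_left h hc0,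
      mul_le_mul_of_nonneg_right hc (sq_nonneg ‖x‖)]

theorem approx_le_one (hc0 : 0 ≤ c) : approx B c ≤ 1 := by
  have h : 0 ≤ c • (star B * B) := smul_nonneg hc0 (star_mul_self_nonneg B)
  have : approx B c = 1 - c • (star B * B) := rfl
  rw [this]
  exact sub_le_self _ h

theorem pow_mul_nullProj (n : ℕ) :
    approx B c ^ n * (LinearMap.ker (B : H →ₗ[ℂ] H)).starProjection =
      (LinearMap.ker (B : H →ₗ[ℂ] H)).starProjection := by
  induction n with
  | zero => simp
  | succ n ih =>
    have h : approx B c * (LinearMap.ker (B : H →ₗ[ℂ] H)).starProjection =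
        (LinearMap.ker (B : H →ₗ[ℂ] H)).starProjection := by
      have h0 : B * (LinearMap.ker (B : H →ₗ[ℂ] H)).starProjection = 0 := by
        ext x
        exact (LinearMap.ker (B : H →ₗ[ℂ] H)).starProjection_apply_mem x
      rw [approx, sub_mul, one_mul, smul_mul_assoc, mul_assoc, h0]
      simp
    rw [pow_succ, mul_assoc, h, ih]

theorem nullProj_le_pow (hc0 : 0 ≤ c) (hc : c * ‖B‖ ^ 2 ≤ 1) (n : ℕ) :
    (LinearMap.ker (B : H →ₗ[ℂ] H)).starProjection ≤ approx B c ^ n := by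
  set P := (LinearMap.ker (B : H →ₗ[ℂ] H)).starProjection with hP
  have hPs : IsStarProjection P := isStarProjection_starProjection
  have hT := CStarAlgebra.pow_nonneg (approx_nonneg B c hc0 hc) n
  have h1 : approx B c ^ n * P = P := pow_mul_nullProj B c n
  have h2 : P * approx B c ^ n = P := by
    have := congrArg star h1
    rwa [star_mul, hPs.isSelfAdjoint.star_eq, (IsSelfAdjoint.of_nonneg hT).star_eq] at this
  have h3 : approx B c ^ n - P = star (1 - P) * approx B c ^ n * (1 - P) := by
    rw [star_sub, star_one, hPs.isSelfAdjoint.star_eq, sub_mul, one_mul, h2, mul_sub, mul_one,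
      sub_mul, h1, hPs.isIdempotentElem.eq, sub_self, sub_zero]
  rw [← sub_nonneg, h3]
  exact star_left_conjugate_nonneg hT _

theorem le_nullProj (hc0 : 0 < c) (hc : c * ‖B‖ ^ 2 ≤ 1) {Z : H →L[ℂ] H}
    (hZ : ∀ n, Z ≤ approx B c ^ n) :
    Z ≤ (LinearMap.ker (B : H →ₗ[ℂ] H)).starProjection := by
  set P := (LinearMap.ker (B : H →ₗ[ℂ] H)).starProjection with hP
  set T := approx B c with hTdef
  have hT0 := approx_nonneg B c hc0.le hc
  have hT1 := approx_le_one B c hc0.le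
  have hPs : IsStarProjection P := isStarProjection_starProjection
  have hTn : ∀ n, 0 ≤ T ^ n := fun n => CStarAlgebra.pow_nonneg hT0 n
  have hZs : IsSelfAdjoint Z := by
    have h := (IsSelfAdjoint.one (H →L[ℂ] H)).sub
      (IsSelfAdjoint.of_nonneg (sub_nonneg.2 (hZ 0)))
    simpa using h
  have mono : ∀ {X Y : H →L[ℂ] H}, X ≤ Y → ∀ v : H,
      (inner ℂ (X v) v).re ≤ (inner ℂ (Y v) v).re := by
    intro X Y h v
    have := ((ContinuousLinearMap.le_def X Y).1 h).re_inner_nonneg_left v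
    simpa [inner_sub_left] using this
  have key : ∀ v : H, (inner ℂ (Z v) v).re ≤ (inner ℂ (P v) v).re := by
    have hdense : Dense ((LinearMap.range ((star B * B : H →L[ℂ] H) : H →ₗ[ℂ] H) ⊔
        LinearMap.ker (B : H →ₗ[ℂ] H) : Submodule ℂ H) : Set H) := by
      rw [Submodule.dense_iff_topologicalClosure_eq_top, Submodule.topologicalClosure_eq_top_iff,
        Submodule.eq_bot_iff]
      intro x hx
      rw [← Submodule.inf_orthogonal] at hx
      obtain ⟨h1, h2⟩ := Submodule.mem_inf.1 hx
      have h3 : B x = 0 := by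
        have := Submodule.inner_right_of_mem_orthogonal
          (LinearMap.mem_range_self ((star B * B : H →L[ℂ] H) : H →ₗ[ℂ] H) x) h1
        simp only [ContinuousLinearMap.coe_coe, mul_apply_eq_comp,
          ContinuousLinearMap.star_eq_adjoint, ContinuousLinearMap.adjoint_inner_left] at this
        exact inner_self_eq_zero.1 this
      exact inner_self_eq_zero.1
        (Submodule.inner_right_of_mem_orthogonal (show x ∈ LinearMap.ker (B : H →ₗ[ℂ] H) from h3) h2)
    refine hdense.induction ?_ (isClosed_le (by fun_prop) (by fun_prop))
    intro v hv
    obtain ⟨_, ⟨u, rfl⟩, k, hk, rfl⟩ := Submodule.mem_sup.1 hv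
    simp only [ContinuousLinearMap.coe_coe]
    set w := (star B * B) u with hw
    have hPk : P k = k := Submodule.starProjection_eq_self_iff.2 hk
    have hPw : P w = 0 := by
      rw [hP, Submodule.starProjection_apply_eq_zero_iff]
      intro z hz
      have hz' : B z = 0 := hz
      simp [hw, ContinuousLinearMap.star_eq_adjoint, ContinuousLinearMap.adjoint_inner_right, hz']
    have hTk : ∀ n, (T ^ n) k = k := by
      intro n
      have := congrArg (fun X : H →L[ℂ] H => X k) (pow_mul_nullProj B c n)
      simpa [← hP, ← hTdef, hPk] using this
    have hTw : ∀ n, P ((T ^ n) w) = 0 := by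
      intro n
      have h1 : T ^ n * P = P := pow_mul_nullProj B c n
      have h2 : P * T ^ n = P := by
        have := congrArg star h1
        rwa [star_mul, hPs.isSelfAdjoint.star_eq, (IsSelfAdjoint.of_nonneg (hTn n)).star_eq] at this
      have := congrArg (fun X : H →L[ℂ] H => X w) h2
      simpa [hPw] using this
    have orth : ∀ y : H, P y = 0 → inner ℂ y k = 0 := by
      intro y hy
      have h := Submodule.inner_starProjection_left_eq_right (LinearMap.ker (B : H →ₗ[ℂ] H)) y k
      rw [← hP, hy, hPk] at h
      simpa using h.symm
    -- the quadratic form of `T ^ n` at `w` tends to zero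
    have hlim : Tendsto (fun n => (inner ℂ ((T ^ n) w) w).re) atTop (𝓝 0) := by
      set a : ℕ → ℝ := fun n => (inner ℂ ((T ^ n) u) u).re with ha
      have hanti : Antitone a := fun m n hmn =>
        mono (CStarAlgebra.pow_antitone hT0 hT1 hmn) u
      have hbdd : BddBelow (Set.range a) := by
        refine ⟨0, ?_⟩
        rintro _ ⟨n, rfl⟩
        have h0 := mono (hTn n) u
        rwa [zero_apply, inner_zero_left, Complex.zero_re] at h0
      have hl := tendsto_atTop_ciInf hanti hbdd
      have hl1 := hl.comp (tendsto_add_atTop_nat 1)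
      have hl2 := hl.comp (tendsto_add_atTop_nat 2)
      have hsum := (((hl.sub (hl1.const_mul 2)).add hl2).const_mul ((c ^ 2)⁻¹))
      have hop : ∀ n, T ^ n - (2 : ℂ) • T ^ (n + 1) + T ^ (n + 2) =
          ((c : ℂ) • (star B * B)) * T ^ n * ((c : ℂ) • (star B * B)) := by
        intro n
        have : (c : ℂ) • (star B * B) = 1 - T := by rw [hTdef, approx]; abel
        rw [this, two_smul]
        have hcm : (1 - T) * T ^ n = T ^ n * (1 - T) :=
          ((Commute.one_left _).sub_left (Commute.self_pow T n)).eq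
        rw [hcm, mul_assoc, pow_succ, pow_add, pow_two]
        noncomm_ring
      have hval : ∀ n, (c ^ 2)⁻¹ * (a n - 2 * a (n + 1) + a (n + 2)) =
          (inner ℂ ((T ^ n) w) w).re := by
        intro n
        have h := congrArg (fun X : H →L[ℂ] H => (inner ℂ (X u) u).re) (hop n)
        simp only [add_apply, sub_apply,
          smul_apply, inner_add_left, inner_sub_left, inner_smul_left,
          Complex.add_re, Complex.sub_re, mul_apply_eq_comp, map_smul,
          Complex.conj_ofReal, ContinuousLinearMap.star_eq_adjoint,
          ContinuousLinearMap.adjoint_inner_left] at h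
        have h2 : ((starRingEnd ℂ) 2 * inner ℂ ((T ^ (n + 1)) u) u).re = 2 * a (n + 1) := by
          simp [ha]
        rw [h2, Complex.re_ofReal_mul, Complex.re_ofReal_mul] at h
        have h3 : (inner ℂ ((T ^ n) w) w).re = (inner ℂ (B ((T ^ n) w)) (B u)).re := by
          rw [← ContinuousLinearMap.adjoint_inner_right B]
          rfl
        rw [h3]
        have hc2 : c ≠ 0 := hc0.ne'
        field_simp
        rw [hw]
        simp only [mul_apply_eq_comp, ContinuousLinearMap.star_eq_adjoint]
        linear_combination h
      have hsum' : Tendsto (fun n => (c ^ 2)⁻¹ * (a n - 2 * a (n + 1) + a (n + 2))) atTop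
          (𝓝 0) := by
        have e : (c ^ 2)⁻¹ * ((⨅ i, a i) - 2 * (⨅ i, a i) + ⨅ i, a i) = 0 := by ring
        rw [e] at hsum
        exact hsum
      exact hsum'.congr hval
    have hle : ∀ n, (inner ℂ (Z (w + k)) (w + k)).re ≤
        (inner ℂ ((T ^ n) w) w).re + (inner ℂ k k).re := by
      intro n
      refine (mono (hZ n) (w + k)).trans (le_of_eq ?_)
      have h1 := orth _ (hTw n)
      have h2 : inner ℂ k w = 0 := by rw [← inner_conj_symm, orth w hPw, map_zero]
      change (inner ℂ ((T ^ n) (w + k)) (w + k)).re = _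
      rw [map_add, hTk, inner_add_left, inner_add_right, inner_add_right, h1, h2]
      simp
    have hfin := ge_of_tendsto' (hlim.add_const (inner ℂ k k).re) hle
    have h2 : inner ℂ k w = 0 := by rw [← inner_conj_symm, orth w hPw, map_zero]
    rw [map_add P, hPw, hPk, zero_add, inner_add_right k, h2, zero_add]
    rwa [zero_add] at hfin
  rw [ContinuousLinearMap.le_def, ContinuousLinearMap.isPositive_def']
  refine ⟨hPs.isSelfAdjoint.sub hZs, fun v => ?_⟩
  have := key v
  simpa [ContinuousLinearMap.reApplyInnerSelf_apply, inner_sub_left] using this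

end NullProjection

section WellDefined

variable {M : VonNeumannAlgebra H} {N : VonNeumannAlgebra K}
  {Φ : M.toStarSubalgebra →⋆ₐ[ℂ] N.toStarSubalgebra}

/-- A normal homomorphism preserves inclusions of nullspaces. -/
theorem IsNormalHom.null_le (hΦ : IsNormalHom Φ) {A B : M.toStarSubalgebra}
    (h : ∀ x, (B : H →L[ℂ] H) x = 0 → (A : H →L[ℂ] H) x = 0) (x : K)
    (hx : (Φ B : K →L[ℂ] K) x = 0) : (Φ A : K →L[ℂ] K) x = 0 := by
  let P : M.toStarSubalgebra := ⟨_, nullProj_mem M B.2⟩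
  let Q : N.toStarSubalgebra := ⟨_, nullProj_mem N (Φ B).2⟩
  obtain ⟨c, hc0, hcB, hcΦ⟩ : ∃ c : ℝ, 0 < c ∧ c * ‖(B : H →L[ℂ] H)‖ ^ 2 ≤ 1 ∧
      c * ‖(Φ B : K →L[ℂ] K)‖ ^ 2 ≤ 1 := by
    refine ⟨(‖(B : H →L[ℂ] H)‖ ^ 2 + ‖(Φ B : K →L[ℂ] K)‖ ^ 2 + 1)⁻¹, by positivity, ?_, ?_⟩
    all_goals
      rw [inv_mul_le_iff₀ (by positivity)]
      nlinarith [sq_nonneg ‖(B : H →L[ℂ] H)‖, sq_nonneg ‖(Φ B : K →L[ℂ] K)‖]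
  let t : M.toStarSubalgebra := 1 - (c : ℂ) • (star B * B)
  have ht : ∀ n, ((t ^ n : M.toStarSubalgebra) : H →L[ℂ] H) = approx (B : H →L[ℂ] H) c ^ n :=
    fun n => rfl
  have hΦt : ∀ n, ((Φ (t ^ n) : N.toStarSubalgebra) : K →L[ℂ] K) =
      approx (Φ B : K →L[ℂ] K) c ^ n := by
    intro n
    have : Φ t = 1 - (c : ℂ) • (star (Φ B) * Φ B) := by
      simp only [t, map_sub, map_one, map_smul, map_mul, map_star]
    rw [map_pow, this]
    rfl
  have hT0 := approx_nonneg (B : H →L[ℂ] H) c hc0.le hcB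
  have hT1 := approx_le_one (B : H →L[ℂ] H) c hc0.le
  have hlub : IsLUB (Set.range fun n => 1 - t ^ n) (1 - P) := by
    constructor
    · rintro _ ⟨n, rfl⟩
      have h1 : (P : H →L[ℂ] H) ≤ (t ^ n : M.toStarSubalgebra) := by
        rw [ht]
        exact nullProj_le_pow _ c hc0.le hcB n
      exact sub_le_sub_left h1 (1 : H →L[ℂ] H)
    · intro Z hZ
      have h1 : (1 - Z : H →L[ℂ] H) ≤ P := by
        refine le_nullProj (B : H →L[ℂ] H) c hc0 hcB fun n => ?_
        have h2 : (1 - (t ^ n : M.toStarSubalgebra) : H →L[ℂ] H) ≤ Z :=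
          hZ ⟨n, rfl⟩
        rw [ht] at h2
        exact sub_le_comm.1 h2
      exact (sub_le_comm.1 h1 : (1 - P : H →L[ℂ] H) ≤ Z)
  have himg := hΦ _ _ (Set.range_nonempty _) (by
      rintro _ ⟨n, rfl⟩
      have h1 : IsSelfAdjoint (approx (B : H →L[ℂ] H) c ^ n) :=
        IsSelfAdjoint.of_nonneg (CStarAlgebra.pow_nonneg hT0 n)
      refine (IsSelfAdjoint.one _).sub ?_
      exact Subtype.ext h1) (by
      refine directedOn_range.2 (Monotone.directed_le fun m n hmn => ?_)
      have h1 := CStarAlgebra.pow_antitone hT0 hT1 hmn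
      exact (sub_le_sub_left h1 (1 : H →L[ℂ] H))) hlub
  have hle : Φ (1 - P) ≤ 1 - Q := by
    refine himg.2 ?_
    rintro _ ⟨_, ⟨n, rfl⟩, rfl⟩
    have h1 : (Q : K →L[ℂ] K) ≤ (Φ (t ^ n) : N.toStarSubalgebra) := by
      rw [hΦt]
      exact nullProj_le_pow _ c hc0.le hcΦ n
    rw [map_sub, map_one]
    exact sub_le_sub_left h1 (1 : K →L[ℂ] K)
  have hPs : IsStarProjection (P : H →L[ℂ] H) := isStarProjection_starProjection
  -- `E = I - P` is a projection with `A E = A`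
  have hE : star (1 - P) * (1 - P) = 1 - P := by
    apply Subtype.ext
    change star (1 - (P : H →L[ℂ] H)) * (1 - (P : H →L[ℂ] H)) = 1 - (P : H →L[ℂ] H)
    rw [hPs.one_sub.isSelfAdjoint.star_eq, hPs.one_sub.isIdempotentElem.eq]
  have hAE : A * (1 - P) = A := by
    apply Subtype.ext
    change (A : H →L[ℂ] H) * (1 - (P : H →L[ℂ] H)) = A
    rw [mul_sub, mul_one, sub_eq_self]
    ext y
    exact h _ (Submodule.starProjection_apply_mem
      (LinearMap.ker ((B : H →L[ℂ] H) : H →ₗ[ℂ] H)) y)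
  have hzero : (Φ (1 - P) : K →L[ℂ] K) x = 0 := by
    have hQx : ((1 - Q : N.toStarSubalgebra) : K →L[ℂ] K) x = 0 := by
      change x - (Q : K →L[ℂ] K) x = 0
      rw [sub_eq_zero]
      exact (Submodule.starProjection_eq_self_iff.2 hx).symm
    have h1 := ((ContinuousLinearMap.le_def _ _).1 hle).re_inner_nonneg_left x
    rw [sub_apply, hQx, zero_sub, inner_neg_left] at h1
    have h2 : (Φ (1 - P) : K →L[ℂ] K) =
        star (Φ (1 - P) : K →L[ℂ] K) * (Φ (1 - P) : K →L[ℂ] K) := by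
      conv_lhs => rw [← hE, map_mul, map_star]
      rfl
    rw [h2, mul_apply_eq_comp, ContinuousLinearMap.star_eq_adjoint,
      ContinuousLinearMap.adjoint_inner_left, inner_self_eq_norm_sq_to_K] at h1
    have h3 : ‖(Φ (1 - P) : K →L[ℂ] K) x‖ ^ 2 ≤ 0 := by
      simpa [← Complex.ofReal_pow] using h1
    exact norm_eq_zero.1 (pow_eq_zero_iff two_ne_zero |>.1 (le_antisymm h3 (sq_nonneg _)))
  rw [← hAE, map_mul]
  change (Φ A : K →L[ℂ] K) ((Φ (1 - P) : K →L[ℂ] K) x) = 0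
  rw [hzero, map_zero]

/-- If `ran B₁ ⊆ ran B₂` for `B₁, B₂ ∈ M`, then `B₁ = B₂ C` for some `C ∈ M`. -/
theorem exists_factor (M : VonNeumannAlgebra H) {B₁ B₂ : H →L[ℂ] H} (h₁ : B₁ ∈ M) (h₂ : B₂ ∈ M)
    (h : ∀ x, ∃ y, B₂ y = B₁ x) : ∃ C ∈ M, B₁ = B₂ * C := by
  set L := LinearMap.ker (B₂ : H →ₗ[ℂ] H) with hL
  have huniq : ∀ y y', y ∈ Lᗮ → y' ∈ Lᗮ → B₂ y = B₂ y' → y = y' := by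
    intro y y' hy hy' e
    have h1 : y - y' ∈ L := by
      change B₂ (y - y') = 0
      rw [map_sub, e, sub_self]
    have h2 : y - y' ∈ Lᗮ := sub_mem hy hy'
    exact sub_eq_zero.1 (inner_self_eq_zero.1 (Submodule.inner_right_of_mem_orthogonal h1 h2))
  have hex : ∀ x, ∃ y, y ∈ Lᗮ ∧ B₂ y = B₁ x := by
    intro x
    obtain ⟨y, hy⟩ := h x
    refine ⟨y - L.starProjection y, Submodule.sub_starProjection_mem_orthogonal y, ?_⟩
    have : B₂ (L.starProjection y) = 0 := Submodule.starProjection_apply_mem L y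
    rw [map_sub, this, sub_zero, hy]
  choose f hf1 hf2 using hex
  let g : H →ₗ[ℂ] H :=
    { toFun := f
      map_add' := fun x y => huniq _ _ (hf1 _) (add_mem (hf1 _) (hf1 _)) (by simp [hf2])
      map_smul' := fun a x => huniq _ _ (hf1 _) (Submodule.smul_mem _ _ (hf1 _)) (by simp [hf2]) }
  have hcont : Continuous g := by
    refine g.continuous_of_seq_closed_graph fun w x y hw hy => ?_
    refine huniq _ _ (Submodule.isClosed_orthogonal L |>.mem_of_tendsto hy
      (Filter.Eventually.of_forall fun n => hf1 _)) (hf1 _) ?_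
    have e1 : Tendsto (fun n => B₂ (f (w n))) atTop (𝓝 (B₂ y)) :=
      (B₂.continuous.tendsto _).comp hy
    simp only [hf2] at e1
    change B₂ y = B₂ (f x)
    rw [hf2]
    exact tendsto_nhds_unique e1 ((B₁.continuous.tendsto _).comp hw)
  let C : H →L[ℂ] H := ⟨g, hcont⟩
  have hC : ∀ x, C x = f x := fun x => rfl
  refine ⟨C, ?_, ?_⟩
  · rw [← VonNeumannAlgebra.commutant_commutant M, VonNeumannAlgebra.mem_commutant_iff]
    intro y hy
    have c1 : ∀ x, B₁ (y x) = y (B₁ x) := fun x => by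
      simpa using congrArg (fun X : H →L[ℂ] H => X x)
        (VonNeumannAlgebra.mem_commutant_iff.1 hy B₁ h₁)
    have c2 : ∀ x, B₂ (y x) = y (B₂ x) := fun x => by
      simpa using congrArg (fun X : H →L[ℂ] H => X x)
        (VonNeumannAlgebra.mem_commutant_iff.1 hy B₂ h₂)
    have c3 : ∀ x, B₂ (star y x) = star y (B₂ x) := fun x => by
      simpa using congrArg (fun X : H →L[ℂ] H => X x)
        (VonNeumannAlgebra.mem_commutant_iff.1 (star_mem hy) B₂ h₂)
    ext x
    change y (f x) = f (y x)
    refine huniq _ _ ?_ (hf1 _) ?_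
    · intro k hk
      have hk' : B₂ k = 0 := hk
      rw [← ContinuousLinearMap.adjoint_inner_left]
      refine Submodule.inner_right_of_mem_orthogonal (K := L) ?_ (hf1 x)
      change B₂ (star y k) = 0
      rw [c3, hk', map_zero]
    · rw [c2, hf2, hf2, c1]
  · ext x
    exact (hf2 x).symm

theorem quotient_mono_map (hΦ : IsNormalHom Φ) {A₁ B₁ A₂ B₂ : M.toStarSubalgebra}
    (h₁ : ∀ x, (B₁ : H →L[ℂ] H) x = 0 → (A₁ : H →L[ℂ] H) x = 0)
    (h₂ : ∀ x, (B₂ : H →L[ℂ] H) x = 0 → (A₂ : H →L[ℂ] H) x = 0)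
    (h : quotient (A₁ : H →L[ℂ] H) B₁ ≤ quotient (A₂ : H →L[ℂ] H) B₂) :
    quotient (Φ A₁ : K →L[ℂ] K) (Φ B₁) ≤ quotient (Φ A₂ : K →L[ℂ] K) (Φ B₂) := by
  have hg : ∀ x, ∃ y, (B₂ : H →L[ℂ] H) y = (B₁ : H →L[ℂ] H) x ∧
      (A₂ : H →L[ℂ] H) y = (A₁ : H →L[ℂ] H) x := fun x =>
    (mem_graph_quotient h₂ (_, _)).1
      (LinearPMap.le_graph_of_le h ((mem_graph_quotient h₁ (_, _)).2 ⟨x, rfl, rfl⟩))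
  obtain ⟨C, hCM, hC⟩ := exists_factor M B₁.2 B₂.2 fun x => (hg x).imp fun _ hy => hy.1
  have hA : (A₁ : H →L[ℂ] H) = A₂ * C := by
    ext x
    obtain ⟨y, hy1, hy2⟩ := hg x
    have h3 := h₂ (y - C x) (by rw [map_sub, hy1, hC]; simp)
    rw [map_sub, sub_eq_zero] at h3
    rw [← hy2, h3]
    rfl
  let C' : M.toStarSubalgebra := ⟨C, hCM⟩
  have eA : A₁ = A₂ * C' := Subtype.ext hA
  have eB : B₁ = B₂ * C' := Subtype.ext hC
  refine LinearPMap.le_of_le_graph fun p hp => ?_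
  obtain ⟨u, hu1, hu2⟩ := (mem_graph_quotient (hΦ.null_le h₁) p).1 hp
  refine (mem_graph_quotient (hΦ.null_le h₂) p).2 ⟨(Φ C' : K →L[ℂ] K) u, ?_, ?_⟩
  · rw [← hu1, eB, map_mul]
    rfl
  · rw [← hu2, eA, map_mul]
    rfl

/-- `Φ_aff(A/B) = Φ(A)/Φ(B)` for all `A, B ∈ M` with `null B ⊆ null A`. -/
theorem affMap_quotient (hΦ : IsNormalHom Φ) {A B : M.toStarSubalgebra}
    (h : ∀ x, (B : H →L[ℂ] H) x = 0 → (A : H →L[ℂ] H) x = 0) :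
    affMap Φ (quotient (A : H →L[ℂ] H) B) = quotient (Φ A : K →L[ℂ] K) (Φ B) := by
  have hex : ∃ q : M.toStarSubalgebra × M.toStarSubalgebra,
      (∀ x, (q.2 : H →L[ℂ] H) x = 0 → (q.1 : H →L[ℂ] H) x = 0) ∧
        quotient (A : H →L[ℂ] H) B = quotient (q.1 : H →L[ℂ] H) (q.2 : H →L[ℂ] H) :=
    ⟨(A, B), h, rfl⟩
  rw [affMap, dif_pos hex]
  exact le_antisymm (quotient_mono_map hΦ hex.choose_spec.1 h hex.choose_spec.2.ge)
    (quotient_mono_map hΦ h hex.choose_spec.1 hex.choose_spec.2.le)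

/-- `Φ_aff` maps `M_aff` to `N_aff`. -/
theorem affMap_mem_affiliated (hΦ : IsNormalHom Φ) {T : H →ₗ.[ℂ] H} (hT : T ∈ affiliated M) :
    affMap Φ T ∈ affiliated N := by
  obtain ⟨A, hA, B, hB, h, rfl⟩ := hT
  have e := affMap_quotient (A := ⟨A, hA⟩) (B := ⟨B, hB⟩) hΦ h
  rw [e]
  exact ⟨_, (Φ ⟨A, hA⟩).2, _, (Φ ⟨B, hB⟩).2,
    hΦ.null_le (A := ⟨A, hA⟩) (B := ⟨B, hB⟩) h, rfl⟩

end WellDefined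

/-! ### Positive operators and their positive self-adjoint extensions -/

/-- An unbounded operator is positive if `⟪T x, x⟫` is real and `≥ 0` for all `x ∈ dom T`. -/
def IsPositive (T : H →ₗ.[ℂ] H) : Prop :=
  ∀ x : T.domain, 0 ≤ (inner ℂ (T x) (x : H)).re ∧ (inner ℂ (T x) (x : H)).im = 0

/-- `T` is a positive self-adjoint extension of `S`. -/
def IsPosSelfAdjointExt (S T : H →ₗ.[ℂ] H) : Prop :=
  S ≤ T ∧ IsSelfAdjoint T ∧ IsPositive T

/-- The order of positive self-adjoint operators: `T ≤ T'` if `(T' + I)⁻¹ ≤ (T + I)⁻¹` as bounded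
operators, that is, `⟪u, (T' + I)⁻¹ u⟫ ≤ ⟪u, (T + I)⁻¹ u⟫` for all vectors `u`. Here
`x = (T + I)⁻¹ u` and `x' = (T' + I)⁻¹ u`. Since `I - 2 (T + I)⁻¹ = (T - I) (T + I)⁻¹`, this is
also the operator order of the Krein transforms of `T` and `T'`. -/
def PosLE (T T' : H →ₗ.[ℂ] H) : Prop :=
  ∀ (u : H) (x : T.domain) (x' : T'.domain), T x + (x : H) = u → T' x' + (x' : H) = u →
    (inner ℂ u (x' : H)).re ≤ (inner ℂ u (x : H)).re

/-- `T` is the Krein-von Neumann extension of `S`: the smallest positive self-adjoint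
extension of `S`. -/
def IsKreinVonNeumannExt (S T : H →ₗ.[ℂ] H) : Prop :=
  IsPosSelfAdjointExt S T ∧ ∀ T', IsPosSelfAdjointExt S T' → PosLE T T'

open Classical in
/-- The Krein-von Neumann extension of `S`, if there is one. It is unique: `PosLE` is antisymmetric
on positive self-adjoint operators, as these are determined by their resolvents. -/
def kreinVonNeumannExt (S : H →ₗ.[ℂ] H) : H →ₗ.[ℂ] H :=
  if h : ∃ T, IsKreinVonNeumannExt S T then h.choose else S

/-- The quadratic form `x ↦ ⟪S x, x⟫` on `dom S` (its real part, when `S` is not positive). -/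
def quadForm (S : H →ₗ.[ℂ] H) (x : S.domain) : ℝ := (inner ℂ (S x) (x : H)).re

theorem quadForm_add_le {S : H →ₗ.[ℂ] H} (hS : IsPositive S) (x y : S.domain) :
    quadForm S (x + y) ≤ 2 * quadForm S x + 2 * quadForm S y := by
  have h := (hS (x - y)).1
  simp only [quadForm, LinearPMap.map_add, LinearPMap.map_sub, Submodule.coe_add,
    AddSubgroupClass.coe_sub, inner_add_left, inner_add_right, inner_sub_left, inner_sub_right,
    Complex.add_re, Complex.sub_re] at h ⊢
  linarith

theorem quadForm_smul (S : H →ₗ.[ℂ] H) (c : ℂ) (x : S.domain) :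
    quadForm S (c • x) = ‖c‖ ^ 2 * quadForm S x := by
  simp only [quadForm, LinearPMap.map_smul, Submodule.coe_smul, inner_smul_left, inner_smul_right]
  rw [← mul_assoc, mul_comm c, mul_comm _ c, Complex.mul_conj, Complex.re_ofReal_mul,
    Complex.normSq_eq_norm_sq]

/-- The domain of the closure of the quadratic form `q(x) = ⟪S x, x⟫` of a positive operator:
all limits in `H` of sequences in `dom S` that are Cauchy with respect to `q`. -/
def formDomain (S : H →ₗ.[ℂ] H) (hS : IsPositive S) : Submodule ℂ H where
  carrier := {x | ∃ w : ℕ → S.domain, Tendsto (fun n => (w n : H)) atTop (𝓝 x) ∧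
    Tendsto (fun p : ℕ × ℕ => quadForm S (w p.1 - w p.2)) atTop (𝓝 0)}
  zero_mem' := ⟨fun _ => 0, by simp, by simp [quadForm]⟩
  add_mem' := by
    rintro x y ⟨w, hw, hw'⟩ ⟨z, hz, hz'⟩
    refine ⟨fun n => w n + z n, by simpa using hw.add hz, ?_⟩
    refine squeeze_zero (fun p => (hS _).1) (fun p => ?_)
      (by simpa using (hw'.const_mul 2).add (hz'.const_mul 2))
    have := quadForm_add_le hS (w p.1 - w p.2) (z p.1 - z p.2)
    rwa [sub_add_sub_comm] at this
  smul_mem' := by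
    rintro c x ⟨w, hw, hw'⟩
    refine ⟨fun n => c • w n, by simpa using hw.const_smul c, ?_⟩
    simp only [← smul_sub, quadForm_smul]
    simpa using hw'.const_mul (‖c‖ ^ 2)

open Classical in
/-- The Friedrichs extension of a densely defined positive operator `S`: the restriction of the
adjoint `S*` to those vectors of `dom S*` that lie in the domain of the closure of the quadratic
form of `S`. -/
def friedrichsExt (S : H →ₗ.[ℂ] H) : H →ₗ.[ℂ] H :=
  if hS : IsPositive S then S.adjoint.domRestrict (formDomain S hS) else S

end AffiliatedOperators

end

set_option linter.unusedSectionVars false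

open Filter Topology

namespace AffiliatedOperators

universe u v

variable {H : Type u} [NormedAddCommGroup H] [InnerProductSpace ℂ H] [CompleteSpace H]
variable {K : Type v} [NormedAddCommGroup K] [InnerProductSpace ℂ K] [CompleteSpace K]

/-! ### Square roots and Douglas factorization in a von Neumann algebra -/

/-! Everything is encoded by bounded operators of `M` satisfying conditions that `Φ` preserves. As
`S` is closed and positive, `S + I` is injective with closed range. Let `E` be the projection onto
that range and `X = (S + I)⁻¹ E`; then `S = (E - X)/X`. Density and positivity of `S` become
conditions on the pair: `X E = X`, two nullspace inclusions and `X* X ≤ E X` (`IsResolventPair`,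
`exists_isResolventPair`). Conversely, any such pair yields a densely defined closed positive
operator.

A positive self-adjoint `T` equals `(I - Y)/Y` with `Y = (T + I)⁻¹` and `0 ≤ Y ≤ I`, and `T` extends
`S` exactly when `Y E = X`. Extending `S` is thus completing a positive contraction with prescribed
values on `ran E`. Write `X = W h` and `E - X = V k`, with `h² = E X`, `k² = E (E - X)`, and `W`,
`V` vanishing on the nullspaces of `h`, `k`. Then `W W*` is a completion of `X`, and it is the
resolvent of the Friedrichs extension because its range lies in the form domain
(`friedrichsExt_eq`). Likewise `V V*` is the least positive completion of `E - X`, so `I - V V*` is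
the largest admissible `Y`, that is, the resolvent of the Krein–von Neumann extension
(`isKreinVonNeumannExt`).

Products, adjoints and operator inequalities are preserved by any `*`-homomorphism, and nullspace
inclusions by a normal one (`IsNormalHom.null_le`). Hence `Φ` carries `E, X, W, h, V, k` to the
corresponding data for `Φ_aff(S)`, and both identities follow by reading off the quotients. -/

theorem exists_nonneg_mul_self_eq (M : VonNeumannAlgebra H) {a : H →L[ℂ] H} (ha : a ∈ M)
    (h0 : 0 ≤ a) : ∃ h ∈ M, IsSelfAdjoint h ∧ h * h = a := by
  refine ⟨CFC.sqrt a, ?_, IsSelfAdjoint.of_nonneg (CFC.sqrt_nonneg a), CFC.sqrt_mul_sqrt_self a h0⟩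
  rw [← VonNeumannAlgebra.commutant_commutant M, VonNeumannAlgebra.mem_commutant_iff]
  intro y hy
  have hc : Commute a y := VonNeumannAlgebra.mem_commutant_iff.1 hy a ha
  -- Whatever commutes with `a` commutes with its square root, so the root lies in the bicommutant.
  exact (hc.cfcₙ_nnreal NNReal.sqrt).eq.symm

theorem inner_star_left (A : H →L[ℂ] H) (x y : H) :
    inner ℂ ((star A : H →L[ℂ] H) x) y = inner ℂ x (A y) :=
  ContinuousLinearMap.adjoint_inner_left A y x

theorem inner_star_right (A : H →L[ℂ] H) (x y : H) :
    inner ℂ x ((star A : H →L[ℂ] H) y) = inner ℂ (A x) y :=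
  ContinuousLinearMap.adjoint_inner_right A x y

theorem re_inner_self (x : H) : (inner ℂ x x).re = ‖x‖ ^ 2 :=
  inner_self_eq_norm_sq (𝕜 := ℂ) x

theorem re_inner_symm (x y : H) : (inner ℂ x y).re = (inner ℂ y x).re :=
  inner_re_symm (𝕜 := ℂ) x y

theorem re_inner_mono {A B : H →L[ℂ] H} (h : A ≤ B) (v : H) :
    (inner ℂ (A v) v).re ≤ (inner ℂ (B v) v).re := by
  have := ((ContinuousLinearMap.le_def A B).1 h).re_inner_nonneg_left v
  simpa [inner_sub_left] using this

theorem le_of_re_inner_le {A B : H →L[ℂ] H} (hA : IsSelfAdjoint A) (hB : IsSelfAdjoint B)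
    (h : ∀ v, (inner ℂ (A v) v).re ≤ (inner ℂ (B v) v).re) : A ≤ B := by
  rw [ContinuousLinearMap.le_def, ContinuousLinearMap.isPositive_def']
  refine ⟨hB.sub hA, fun v => ?_⟩
  simpa [ContinuousLinearMap.reApplyInnerSelf_apply, inner_sub_left] using h v

/-- `A = W h` with `h` self-adjoint, where `W` vanishes on the nullspace of `h`. -/
structure IsFactorization (A W h : H →L[ℂ] H) : Prop where
  isSelfAdjoint : IsSelfAdjoint h
  eq_mul : A = W * h
  ker_le : ∀ x, h x = 0 → W x = 0

/-- Douglas factorization inside `M`: with `h = D^(1/2)` the hypothesis reads `‖A x‖ ≤ ‖h x‖`, so `h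
x ↦ A x` is a well-defined contraction on `ran h`. -/
theorem exists_isFactorization (M : VonNeumannAlgebra H) {A D : H →L[ℂ] H} (hA : A ∈ M)
    (hD : D ∈ M) (hAD : star A * A ≤ D) :
    ∃ W ∈ M, ∃ h ∈ M, IsFactorization A W h ∧ h * h = D := by
  obtain ⟨h, hM, hs, hh⟩ := exists_nonneg_mul_self_eq M hD ((star_mul_self_nonneg A).trans hAD)
  have hle : ∀ x, ‖A x‖ ≤ ‖h x‖ := fun x => by
    refine le_of_sq_le_sq ?_ (norm_nonneg _)
    have h1 := re_inner_mono hAD x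
    rwa [mul_apply_eq_comp, inner_star_left, re_inner_self, ← hh, mul_apply_eq_comp,
      ← inner_star_right, hs.star_eq, re_inner_self] at h1
  set R : Submodule ℂ H := (LinearMap.range (h : H →ₗ[ℂ] H)).topologicalClosure with hR
  have : IsClosed (R : Set H) := Submodule.isClosed_topologicalClosure _
  have : CompleteSpace R := this.completeSpace_coe
  let e : H →ₗ[ℂ] R := (h : H →ₗ[ℂ] H).codRestrict R
    fun x => Submodule.le_topologicalClosure _ (LinearMap.mem_range_self _ x)
  have he : DenseRange e := by
    intro y
    rw [Metric.mem_closure_iff]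
    intro ε hε
    obtain ⟨_, ⟨x, rfl⟩, hx⟩ := Metric.mem_closure_iff.1
      (show (y : H) ∈ closure (LinearMap.range (h : H →ₗ[ℂ] H) : Set H) from y.2) ε hε
    exact ⟨e x, ⟨x, rfl⟩, hx⟩
  let V : R →L[ℂ] H := (A : H →ₗ[ℂ] H).extendOfNorm e
  have hV : ∀ x, V (e x) = A x :=
    LinearMap.extendOfNorm_eq he ⟨1, fun x => by rw [one_mul]; exact hle x⟩
  let W₀ : H →L[ℂ] H := V ∘L R.orthogonalProjectionOnto
  have hW₀ : A = W₀ * h := by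
    ext x
    change A x = V (R.orthogonalProjectionOnto (h x))
    rw [← hV x]
    congr 1
    exact (Submodule.orthogonalProjectionOnto_mem_subspace_eq_self (e x)).symm
  have hA' : star A = h * star W₀ := by rw [hW₀, star_mul, hs.star_eq]
  -- `W₀` serves only to show `ran A* ⊆ ran h`; the factor in `M` comes from `exists_factor`.
  obtain ⟨C, hC, hC'⟩ := exists_factor M (star_mem hA) hM fun x => ⟨star W₀ x, by rw [hA']; rfl⟩
  have hP := nullProj_mem M hM
  set P := (LinearMap.ker (h : H →ₗ[ℂ] H)).starProjection with hPdef
  have hPs : IsStarProjection P := isStarProjection_starProjection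
  have hhP : h * P = 0 := by
    ext x
    exact (LinearMap.ker (h : H →ₗ[ℂ] H)).starProjection_apply_mem x
  have hPh : P * h = 0 := by
    have := congrArg star hhP
    rwa [star_mul, hPs.isSelfAdjoint.star_eq, hs.star_eq, star_zero] at this
  -- The factor `1 - P` forces vanishing on the nullspace of `h`, and the product with `h` is
  -- unchanged since `P h = 0`.
  refine ⟨star C * (1 - P), mul_mem (star_mem hC) (sub_mem (one_mem _) hP), h, hM,
    ⟨hs, ?_, ?_⟩, hh⟩
  · rw [mul_assoc, sub_mul, one_mul, hPh, sub_zero, ← star_star A, hC', star_mul, hs.star_eq]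
  · intro x hx
    have : P x = x := Submodule.starProjection_eq_self_iff.2 hx
    simp [this]

/-- `ran W*` is orthogonal to the nullspace of `h`, and `h` is self-adjoint. This is what makes `W
W*` extremal. -/
theorem IsFactorization.star_apply_mem_closure {A W h : H →L[ℂ] H} (hf : IsFactorization A W h)
    (u : H) : (star W : H →L[ℂ] H) u ∈ closure (Set.range h) := by
  have h1 : (star W : H →L[ℂ] H) u ∈ (LinearMap.ker (h : H →ₗ[ℂ] H))ᗮ := by
    rw [Submodule.mem_orthogonal]
    intro k hk
    rw [inner_star_right, hf.ker_le k hk, inner_zero_left]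
  have h2 : (LinearMap.range (h : H →ₗ[ℂ] H))ᗮ ≤ LinearMap.ker (h : H →ₗ[ℂ] H) := by
    intro x hx
    have h3 : inner ℂ (h (h x)) x = 0 :=
      Submodule.inner_right_of_mem_orthogonal (LinearMap.mem_range_self (h : H →ₗ[ℂ] H) (h x)) hx
    have h4 := inner_star_left h (h x) x
    rw [hf.isSelfAdjoint.star_eq, h3] at h4
    exact inner_self_eq_zero.1 h4.symm
  have h3 := Submodule.orthogonal_le h2 h1
  rw [Submodule.orthogonal_orthogonal_eq_closure] at h3
  exact h3

/-- Since `⟪u, A v⟫ = ⟪W* u, h v⟫`, the hypothesis is a closed condition on `y = h v`; by density it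
may be evaluated at `y = W* u`. -/
theorem IsFactorization.norm_star_apply_sq_le {A W h : H →L[ℂ] H} (hf : IsFactorization A W h)
    {u : H} {c : ℝ} (hc : ∀ v, 2 * (inner ℂ u (A v)).re ≤ c + ‖h v‖ ^ 2) :
    ‖(star W : H →L[ℂ] H) u‖ ^ 2 ≤ c := by
  set w := (star W : H →L[ℂ] H) u with hw
  have hcl : IsClosed {y : H | 2 * (inner ℂ w y).re ≤ c + ‖y‖ ^ 2} :=
    isClosed_le (by fun_prop) (by fun_prop)
  have hsub : Set.range h ⊆ {y : H | 2 * (inner ℂ w y).re ≤ c + ‖y‖ ^ 2} := by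
    rintro _ ⟨v, rfl⟩
    have := hc v
    rw [hf.eq_mul] at this
    change 2 * (inner ℂ w (h v)).re ≤ _
    rwa [hw, inner_star_left]
  have := closure_minimal hsub hcl (hf.star_apply_mem_closure u)
  change 2 * (inner ℂ w w).re ≤ _ at this
  rw [re_inner_self] at this
  linarith

/-! ### Graphs of quotients -/

theorem exists_apply_eq {A B : H →L[ℂ] H} (h : ∀ x, B x = 0 → A x = 0)
    (x : (quotient A B).domain) : ∃ u, B u = x ∧ A u = quotient A B x :=
  (mem_graph_quotient h _).1 ((quotient A B).mem_graph x)

theorem exists_domain_eq {A B : H →L[ℂ] H} (h : ∀ x, B x = 0 → A x = 0) (u : H) :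
    ∃ x : (quotient A B).domain, (x : H) = B u ∧ quotient A B x = A u :=
  (LinearPMap.mem_graph_iff _).1 ((mem_graph_quotient h (B u, A u)).2 ⟨u, rfl, rfl⟩)

theorem exists_of_quotient_le {A B : H →L[ℂ] H} (h : ∀ x, B x = 0 → A x = 0) {T : H →ₗ.[ℂ] H}
    (hT : quotient A B ≤ T) (u : H) : ∃ x : T.domain, (x : H) = B u ∧ T x = A u :=
  (LinearPMap.mem_graph_iff _).1
    (LinearPMap.le_graph_of_le hT ((mem_graph_quotient h (B u, A u)).2 ⟨u, rfl, rfl⟩))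

/-! ### Positive operators -/

/-- Polarization: a form that is real at `x + y` and `x + i y` is symmetric. -/
theorem IsPositive.isFormalAdjoint {T : H →ₗ.[ℂ] H} (hT : IsPositive T) (x y : T.domain) :
    inner ℂ (T x) (y : H) = inner ℂ (x : H) (T y) := by
  have key : ∀ z : T.domain, inner ℂ (T z) (z : H) = inner ℂ (z : H) (T z) := fun z => by
    rw [← inner_conj_symm (z : H)]
    exact (Complex.conj_eq_iff_im.2 (hT z).2).symm
  have hI : (Complex.I : ℂ) * Complex.I = -1 := Complex.I_mul_I
  have h1 := key (x + y)
  have h2 := key (x + Complex.I • y)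
  simp only [LinearPMap.map_add, LinearPMap.map_smul, Submodule.coe_add, Submodule.coe_smul,
    inner_add_left, inner_add_right, inner_smul_left, inner_smul_right, key x, key y,
    Complex.conj_I] at h1 h2
  have h3 : Complex.I * (inner ℂ (T x) (y : H) - inner ℂ (T y) (x : H)) =
      Complex.I * (inner ℂ (x : H) (T y) - inner ℂ (y : H) (T x)) := by
    linear_combination h2
  have h4 := mul_left_cancel₀ Complex.I_ne_zero h3
  linear_combination (h1 + h4) / 2

theorem IsPositive.norm_le {T : H →ₗ.[ℂ] H} (hT : IsPositive T) (x : T.domain) :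
    ‖(x : H)‖ ≤ ‖T x + (x : H)‖ := by
  refine le_of_sq_le_sq ?_ (norm_nonneg _)
  rw [← re_inner_self, ← re_inner_self (T x + (x : H))]
  have h1 := (hT x).1
  have h2 := re_inner_symm (T x) (x : H)
  simp only [inner_add_left, inner_add_right, Complex.add_re]
  rw [re_inner_self (T x)]
  nlinarith [sq_nonneg ‖T x‖]

theorem IsPositive.eq_of_add_eq {T : H →ₗ.[ℂ] H} (hT : IsPositive T) {x y : T.domain}
    (h : T x + (x : H) = T y + (y : H)) : x = y := by
  have h1 := hT.norm_le (x - y)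
  have h2 : T (x - y) + ((x - y : T.domain) : H) = 0 := by
    rw [LinearPMap.map_sub, AddSubgroupClass.coe_sub]
    rw [← add_sub_add_comm, h, sub_self]
  rw [h2, norm_zero] at h1
  exact sub_eq_zero.1 (Subtype.ext (norm_le_zero_iff.1 h1))

/-- The range of `T + I`. -/
def shiftRange (T : H →ₗ.[ℂ] H) : Submodule ℂ H :=
  LinearMap.range (T.toFun + T.domain.subtype)

theorem mem_shiftRange {T : H →ₗ.[ℂ] H} {y : H} :
    y ∈ shiftRange T ↔ ∃ x : T.domain, T x + (x : H) = y := Iff.rfl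

/-- By `norm_le`, preimages under `T + I` of a Cauchy sequence are Cauchy; closedness of `T` handles
the limit. -/
theorem IsPositive.isClosed_shiftRange {T : H →ₗ.[ℂ] H} (hT : IsPositive T) (hc : T.IsClosed) :
    IsClosed (shiftRange T : Set H) := by
  refine IsSeqClosed.isClosed fun y a hy hya => ?_
  choose x hx using hy
  have hx' : ∀ n, T (x n) + (x n : H) = y n := hx
  have hcau : CauchySeq fun n => (x n : H) := by
    have h1 := hya.cauchySeq
    rw [Metric.cauchySeq_iff] at h1 ⊢
    intro ε hε
    obtain ⟨N, hN⟩ := h1 ε hε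
    refine ⟨N, fun m hm n hn => lt_of_le_of_lt ?_ (hN m hm n hn)⟩
    rw [dist_eq_norm, dist_eq_norm, ← hx', ← hx']
    have := hT.norm_le (x m - x n)
    rw [LinearPMap.map_sub, AddSubgroupClass.coe_sub] at this
    rwa [add_sub_add_comm]
  obtain ⟨b, hb⟩ := cauchySeq_tendsto_of_complete hcau
  have hT' : Tendsto (fun n => T (x n)) atTop (𝓝 (a - b)) :=
    (hya.sub hb).congr fun n => by rw [← hx' n, add_sub_cancel_right]
  have hg : ((b, a - b) : H × H) ∈ T.graph :=
    hc.mem_of_tendsto (hb.prodMk_nhds hT') (Eventually.of_forall fun n => T.mem_graph (x n))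
  obtain ⟨z, hz1, hz2⟩ := (LinearPMap.mem_graph_iff _).1 hg
  exact ⟨z, by change T z + (z : H) = a; simp only at hz1 hz2; rw [hz1, hz2]; abel⟩

/-! ### Positive self-adjoint operators through their resolvents at `-1` -/

theorem ker_le_one_sub {Y : H →L[ℂ] H} (hY : ∀ x, Y x = 0 → x = 0) (x : H) (hx : Y x = 0) :
    (1 - Y) x = 0 := by
  simp [hY x hx]

theorem isPositive_quotient {Y : H →L[ℂ] H} (h0 : 0 ≤ Y) (h1 : Y ≤ 1)
    (hY : ∀ x, Y x = 0 → x = 0) : IsPositive (quotient (1 - Y) Y) := by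
  intro x
  obtain ⟨u, hu, hu'⟩ := exists_apply_eq (ker_le_one_sub hY) x
  set R := CFC.sqrt Y
  have hR : IsSelfAdjoint R := IsSelfAdjoint.of_nonneg (CFC.sqrt_nonneg Y)
  have hRR : R * R = Y := CFC.sqrt_mul_sqrt_self Y h0
  have hRu : ∀ v w, inner ℂ v (R w) = inner ℂ (R v) w := fun v w => by
    rw [← inner_star_left, hR.star_eq]
  -- Half of `Y` is moved to the left entry, exposing a value of the positive form of `1 - Y`.
  have e : inner ℂ ((1 - Y) u) (Y u) = inner ℂ ((1 - Y) (R u)) (R u) := by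
    have hc : R * (1 - Y) = (1 - Y) * R := by rw [← hRR]; noncomm_ring
    rw [← hRR, mul_apply_eq_comp, hRu, hRR]
    congr 1
    exact congrArg (fun T : H →L[ℂ] H => T u) hc
  rw [← hu, ← hu', e]
  have := ((ContinuousLinearMap.le_def Y 1).1 h1).inner_nonneg_left (R u)
  rw [Complex.nonneg_iff] at this
  exact ⟨this.1, this.2.symm⟩

theorem isSelfAdjoint_quotient {Y : H →L[ℂ] H} (hs : IsSelfAdjoint Y)
    (hY : ∀ x, Y x = 0 → x = 0) : IsSelfAdjoint (quotient (1 - Y) Y) := by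
  have hk := ker_le_one_sub hY
  have hYu : ∀ v w, inner ℂ v (Y w) = inner ℂ (Y v) w := fun v w => by
    rw [← inner_star_left, hs.star_eq]
  have hd : Dense ((quotient (1 - Y) Y).domain : Set H) := by
    rw [Submodule.dense_iff_topologicalClosure_eq_top, Submodule.topologicalClosure_eq_top_iff,
      Submodule.eq_bot_iff]
    intro x hx
    refine hY x (ext_inner_left ℂ fun w => ?_)
    obtain ⟨z, hz, -⟩ := exists_domain_eq hk w
    rw [hYu, ← hz, inner_zero_right]
    exact Submodule.inner_right_of_mem_orthogonal z.2 hx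
  rw [LinearPMap.isSelfAdjoint_def]
  refine le_antisymm (LinearPMap.le_of_le_graph fun p hp => ?_) ?_
  · obtain ⟨y, hy1, hy2⟩ := (LinearPMap.mem_graph_iff _).1 hp
    -- Testing the adjoint relation against `(Y w, w - Y w)` for all `w` gives `p.1 = Y (p.1 +
    -- p.2)`, which puts `p` back in the graph.
    have key : Y p.2 = p.1 - Y p.1 := by
      refine ext_inner_right ℂ fun w => ?_
      obtain ⟨z, hz1, hz2⟩ := exists_domain_eq hk w
      have h1 := LinearPMap.adjoint_isFormalAdjoint hd y z
      rw [hz1, hz2, hy1, hy2, hYu] at h1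
      rw [h1, inner_sub_left, ← hYu, ← inner_sub_right]
      rfl
    refine (mem_graph_quotient hk p).2 ⟨p.2 + p.1, ?_, ?_⟩
    · rw [map_add, key, sub_add_cancel]
    · change p.2 + p.1 - Y (p.2 + p.1) = p.2
      rw [map_add, key]
      abel
  · refine LinearPMap.IsFormalAdjoint.le_adjoint hd fun x y => ?_
    obtain ⟨u, hu, hu'⟩ := exists_apply_eq hk x
    obtain ⟨w, hw, hw'⟩ := exists_apply_eq hk y
    rw [← hu, ← hu', ← hw, ← hw']
    change inner ℂ (u - Y u) (Y w) = inner ℂ (Y u) (w - Y w)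
    rw [hYu, map_sub, inner_sub_left, inner_sub_right, hYu (Y u) w]

/-- A vector `y` orthogonal to the closed range satisfies `T y = T* y = -y`, which contradicts
positivity unless `y = 0`. -/
theorem IsPositive.shiftRange_eq_top {T : H →ₗ.[ℂ] H} (hT : IsPositive T) (hs : IsSelfAdjoint T) :
    shiftRange T = ⊤ := by
  have hcl := hT.isClosed_shiftRange hs.isClosed
  rw [← hcl.submodule_topologicalClosure_eq, Submodule.topologicalClosure_eq_top_iff,
    Submodule.eq_bot_iff]
  intro y hy
  have h1 : ∀ x : T.domain, inner ℂ (-y) (x : H) = inner ℂ y (T x) := fun x => by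
    have := Submodule.inner_left_of_mem_orthogonal (mem_shiftRange.2 ⟨x, rfl⟩) hy
    rw [inner_add_right] at this
    rw [inner_neg_left]
    linear_combination -this
  have h2 : y ∈ T.adjoint.domain := LinearPMap.mem_adjoint_domain_of_exists y ⟨-y, h1⟩
  have h3 : T.adjoint ⟨y, h2⟩ = -y := LinearPMap.adjoint_apply_eq hs.dense_domain _ h1
  have h4 : ((y, -y) : H × H) ∈ T.graph := by
    rw [← LinearPMap.isSelfAdjoint_def.1 hs, LinearPMap.mem_graph_iff]
    exact ⟨⟨y, h2⟩, rfl, h3⟩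
  obtain ⟨x, hx1, hx2⟩ := (LinearPMap.mem_graph_iff _).1 h4
  have h5 := (hT x).1
  simp only at hx1 hx2
  rw [hx1, hx2, inner_neg_left, Complex.neg_re, re_inner_self] at h5
  exact norm_eq_zero.1 (pow_eq_zero_iff two_ne_zero |>.1
    (le_antisymm (by linarith) (sq_nonneg _)))

/-- A positive self-adjoint operator is `(I - Y)/Y`, where `Y = (T + I)⁻¹` is bounded. -/
theorem IsPositive.exists_eq_quotient {T : H →ₗ.[ℂ] H} (hT : IsPositive T)
    (hs : IsSelfAdjoint T) :
    ∃ Y : H →L[ℂ] H, IsSelfAdjoint Y ∧ (∀ x, Y x = 0 → x = 0) ∧ T = quotient (1 - Y) Y := by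
  have hsurj : ∀ u, ∃ x : T.domain, T x + (x : H) = u := fun u => by
    rw [← mem_shiftRange, hT.shiftRange_eq_top hs]
    trivial
  choose f hf using hsurj
  let g : H →ₗ[ℂ] H :=
    { toFun := fun u => f u
      map_add' := fun x y => by
        rw [← Submodule.coe_add]
        congr 1
        refine hT.eq_of_add_eq ?_
        rw [hf, LinearPMap.map_add, Submodule.coe_add, add_add_add_comm, hf, hf]
      map_smul' := fun a x => by
        rw [RingHom.id_apply, ← Submodule.coe_smul]
        congr 1
        refine hT.eq_of_add_eq ?_
        rw [hf, LinearPMap.map_smul, Submodule.coe_smul, ← smul_add, hf] }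
  let Y : H →L[ℂ] H := g.mkContinuous 1 fun u => by
    rw [one_mul]
    exact (hT.norm_le (f u)).trans_eq (by rw [hf])
  have hY : ∀ u, Y u = f u := fun u => rfl
  have hTf : ∀ u, T (f u) = (1 - Y) u := fun u => by
    change T (f u) = u - Y u
    rw [eq_sub_iff_add_eq, hY, hf]
  have hinj : ∀ x, Y x = 0 → x = 0 := fun x hx => by
    have h1 : f x = 0 := Subtype.ext hx
    rw [← hf x, h1]
    simp
  refine ⟨Y, ?_, hinj, LinearPMap.eq_of_eq_graph (SetLike.ext fun p => ?_)⟩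
  · rw [ContinuousLinearMap.isSelfAdjoint_iff_isSymmetric]
    intro x y
    have h1 := hT.isFormalAdjoint (f x) (f y)
    change inner ℂ (f x : H) y = inner ℂ x (f y : H)
    nth_rw 1 [← hf y]
    nth_rw 2 [← hf x]
    rw [inner_add_left, inner_add_right, h1]
  · rw [mem_graph_quotient (ker_le_one_sub hinj), LinearPMap.mem_graph_iff]
    constructor
    · rintro ⟨x, hx1, hx2⟩
      have h1 : f (p.2 + p.1) = x := hT.eq_of_add_eq (by rw [hf, hx1, hx2])
      refine ⟨p.2 + p.1, ?_, ?_⟩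
      · rw [hY, h1, hx1]
      · rw [← hTf, h1, hx2]
    · rintro ⟨u, hu1, hu2⟩
      exact ⟨f u, hu1, (hTf u).trans hu2⟩

theorem le_of_posLE {Y Y' : H →L[ℂ] H} (hs : IsSelfAdjoint Y) (hs' : IsSelfAdjoint Y')
    (hY : ∀ x, Y x = 0 → x = 0) (hY' : ∀ x, Y' x = 0 → x = 0)
    (h : PosLE (quotient (1 - Y) Y) (quotient (1 - Y') Y')) : Y' ≤ Y := by
  refine le_of_re_inner_le hs' hs fun u => ?_
  obtain ⟨x, hx, hx'⟩ := exists_domain_eq (ker_le_one_sub hY) u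
  obtain ⟨y, hy, hy'⟩ := exists_domain_eq (ker_le_one_sub hY') u
  have := h u x y (by rw [hx, hx']; simp) (by rw [hy, hy']; simp)
  rwa [hx, hy, re_inner_symm u, re_inner_symm u] at this

theorem IsKreinVonNeumannExt.unique {S T T' : H →ₗ.[ℂ] H} (hT : IsKreinVonNeumannExt S T)
    (hT' : IsKreinVonNeumannExt S T') : T = T' := by
  obtain ⟨Y, hs, hY, rfl⟩ := hT.1.2.2.exists_eq_quotient hT.1.2.1
  obtain ⟨Y', hs', hY', rfl⟩ := hT'.1.2.2.exists_eq_quotient hT'.1.2.1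
  have : Y = Y' := le_antisymm (le_of_posLE hs' hs hY' hY (hT'.2 _ hT.1))
    (le_of_posLE hs hs' hY hY' (hT.2 _ hT'.1))
  rw [this]

theorem IsKreinVonNeumannExt.eq_kreinVonNeumannExt {S T : H →ₗ.[ℂ] H}
    (hT : IsKreinVonNeumannExt S T) : T = kreinVonNeumannExt S := by
  have h : ∃ T, IsKreinVonNeumannExt S T := ⟨T, hT⟩
  rw [kreinVonNeumannExt, dif_pos h]
  exact hT.unique h.choose_spec

/-! ### Closed positive operators as quotients -/

/-- The relations between the projection `E` onto the range of `S + I` and `X = (S + I)⁻¹ E`,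
for a densely defined closed positive operator `S`; then `S = (E - X)/X`. -/
structure IsResolventPair (E X : H →L[ℂ] H) : Prop where
  proj : IsStarProjection E
  mul_proj : X * E = X
  ker_le : ∀ x, X x = 0 → E x = 0
  star_mul_le : star X * X ≤ E * X
  ker_star : ∀ x, (star X : H →L[ℂ] H) x = 0 → x = 0

namespace IsResolventPair

variable {E X : H →L[ℂ] H} (hp : IsResolventPair E X)

include hp

theorem ker_le_sub (x : H) (hx : X x = 0) : (E - X) x = 0 := by
  rw [sub_apply, hx, hp.ker_le x hx, sub_zero]

theorem proj_mul_nonneg : 0 ≤ E * X := (star_mul_self_nonneg X).trans hp.star_mul_le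

/-- As `E X` is self-adjoint, `X* E = E X`, so both inequalities have the same difference of sides.
The one for `X` therefore also allows `E - X` to be factored. -/
theorem star_sub_mul_sub_le : star (E - X) * (E - X) ≤ E * (E - X) := by
  have h1 : star X * E = E * X := by
    have := (IsSelfAdjoint.of_nonneg hp.proj_mul_nonneg).star_eq
    rwa [star_mul, hp.proj.isSelfAdjoint.star_eq] at this
  have h2 : E * (E - X) - star (E - X) * (E - X) = E * X - star X * X := by
    rw [star_sub, hp.proj.isSelfAdjoint.star_eq, sub_mul, sub_sub_cancel, mul_sub, h1]
  rw [← sub_nonneg, h2, sub_nonneg]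
  exact hp.star_mul_le

theorem inner_proj (v w : H) : inner ℂ (E v) w = inner ℂ v (E w) := by
  rw [← inner_star_left, hp.proj.isSelfAdjoint.star_eq]

theorem proj_proj (v : H) : E (E v) = E v :=
  congrArg (fun T : H →L[ℂ] H => T v) hp.proj.isIdempotentElem.eq

theorem apply_proj (v : H) : X (E v) = X v :=
  congrArg (fun T : H →L[ℂ] H => T v) hp.mul_proj

/-- For `x = X v` one has `(S + I) x = E v`, so this says `⟪S x, x⟫ ≥ 0`. -/
theorem norm_sq_le (v : H) : ‖X v‖ ^ 2 ≤ (inner ℂ (E v) (X v)).re := by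
  have := re_inner_mono hp.star_mul_le v
  rwa [mul_apply_eq_comp, inner_star_left, re_inner_self, mul_apply_eq_comp, hp.inner_proj,
    re_inner_symm] at this

theorem im_inner (v : H) : (inner ℂ (E v) (X v)).im = 0 := by
  have := ((ContinuousLinearMap.nonneg_iff_isPositive _).1 hp.proj_mul_nonneg).inner_nonneg_right v
  rw [mul_apply_eq_comp, ← hp.inner_proj, Complex.nonneg_iff] at this
  exact this.2.symm

theorem isPositive : IsPositive (quotient (E - X) X) := by
  intro x
  obtain ⟨u, hu, hu'⟩ := exists_apply_eq hp.ker_le_sub x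
  rw [← hu, ← hu', sub_apply, inner_sub_left, Complex.sub_re, Complex.sub_im, re_inner_self,
    hp.im_inner, zero_sub, neg_eq_zero]
  exact ⟨sub_nonneg.2 (hp.norm_sq_le u), inner_self_im (𝕜 := ℂ) _⟩

theorem dense : Dense ((quotient (E - X) X).domain : Set H) := by
  rw [Submodule.dense_iff_topologicalClosure_eq_top, Submodule.topologicalClosure_eq_top_iff,
    Submodule.eq_bot_iff]
  intro x hx
  refine hp.ker_star x (ext_inner_left ℂ fun w => ?_)
  obtain ⟨z, hz, -⟩ := exists_domain_eq hp.ker_le_sub w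
  rw [inner_star_right, ← hz, inner_zero_right]
  exact Submodule.inner_right_of_mem_orthogonal z.2 hx

theorem isClosed : (quotient (E - X) X).IsClosed := by
  -- The graph is cut out by two continuous equations, hence is closed.
  have : ((quotient (E - X) X).graph : Set (H × H)) =
      {p | X (p.1 + p.2) = p.1 ∧ E (p.1 + p.2) = p.1 + p.2} := by
    ext p
    rw [SetLike.mem_coe, mem_graph_quotient hp.ker_le_sub]
    constructor
    · rintro ⟨u, hu1, hu2⟩
      have : p.1 + p.2 = E u := by rw [← hu1, ← hu2, sub_apply]; abel
      rw [Set.mem_ofPred_eq, this]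
      exact ⟨by rw [hp.apply_proj, hu1], hp.proj_proj u⟩
    · rintro ⟨h1, h2⟩
      exact ⟨_, h1, by rw [sub_apply, h1, h2]; abel⟩
  rw [LinearPMap.IsClosed, this]
  exact (isClosed_eq (by fun_prop) (by fun_prop)).inter (isClosed_eq (by fun_prop) (by fun_prop))

/-- `S + I` sends `X v` to `E v`, so `Y E = X` says that `Y` inverts `S + I` on its range. -/
theorem quotient_le {Y : H →L[ℂ] H} (hY : ∀ x, Y x = 0 → x = 0) (h : Y * E = X) :
    quotient (E - X) X ≤ quotient (1 - Y) Y := by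
  refine LinearPMap.le_of_le_graph fun p hg => ?_
  obtain ⟨u, hu1, hu2⟩ := (mem_graph_quotient hp.ker_le_sub p).1 hg
  have h' : Y (E u) = X u := congrArg (fun T : H →L[ℂ] H => T u) h
  refine (mem_graph_quotient (ker_le_one_sub hY) p).2 ⟨E u, h'.trans hu1, ?_⟩
  rw [← hu2, sub_apply, sub_apply, h']
  rfl

theorem isPosSelfAdjointExt {Y : H →L[ℂ] H} (h0 : 0 ≤ Y) (h1 : Y ≤ 1)
    (hY : ∀ x, Y x = 0 → x = 0) (h : Y * E = X) :
    IsPosSelfAdjointExt (quotient (E - X) X) (quotient (1 - Y) Y) :=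
  ⟨hp.quotient_le hY h, isSelfAdjoint_quotient (IsSelfAdjoint.of_nonneg h0) hY,
    isPositive_quotient h0 h1 hY⟩

end IsResolventPair

/-! ### The extremal extensions -/

/-- For `A = X` this identifies `‖h v‖²` with the form norm `⟪(S + I) x, x⟫` of `x = X v`. -/
theorem IsFactorization.norm_sq_eq {A W h E : H →L[ℂ] H} (hf : IsFactorization A W h)
    (hh : h * h = E * A) (hE : IsStarProjection E) (v : H) :
    ‖h v‖ ^ 2 = (inner ℂ (E v) (A v)).re := by
  have h1 : inner ℂ (h v) (h v) = inner ℂ v ((h * h) v) := by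
    nth_rw 1 [← hf.isSelfAdjoint.star_eq]
    exact inner_star_left _ _ _
  rw [← re_inner_self, h1, hh, mul_apply_eq_comp, ← inner_star_left, hE.isSelfAdjoint.star_eq]

/-- The difference `h - E W` vanishes both on `ran h` and on the nullspace of `h`, hence everywhere.
-/
theorem IsFactorization.proj_mul_eq {A W h E : H →L[ℂ] H} (hf : IsFactorization A W h)
    (hh : h * h = E * A) : E * W = h := by
  have hs := hf.isSelfAdjoint.star_eq
  have h1 : (h - E * W) * h = 0 := by
    rw [sub_mul, mul_assoc, ← hf.eq_mul, hh, sub_self]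
  have h2 : h * star (h - E * W) = 0 := by
    have := congrArg star h1
    rwa [star_mul, hs, star_zero] at this
  have h3 : star (h - E * W) = 0 := by
    ext x
    have h4 : h (star (h - E * W) x) = 0 := congrArg (fun T : H →L[ℂ] H => T x) h2
    have h5 : (h - E * W) (star (h - E * W) x) = 0 := by
      rw [sub_apply, h4, mul_apply_eq_comp, hf.ker_le _ h4, map_zero, sub_zero]
    rw [zero_apply, ← inner_self_eq_zero (𝕜 := ℂ), inner_star_left, h5, inner_zero_right]
  rw [star_eq_zero, sub_eq_zero] at h3
  exact h3.symm

theorem IsFactorization.mul_star_mul_proj {A W h E : H →L[ℂ] H} (hf : IsFactorization A W h)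
    (hh : h * h = E * A) (hE : IsStarProjection E) : W * star W * E = A := by
  have h1 : star W * E = h := by
    have := congrArg star (hf.proj_mul_eq hh)
    rwa [star_mul, hE.isSelfAdjoint.star_eq, hf.isSelfAdjoint.star_eq] at this
  rw [mul_assoc, h1, hf.eq_mul]

theorem re_inner_mul_star (W : H →L[ℂ] H) (u : H) :
    (inner ℂ ((W * star W) u) u).re = ‖(star W : H →L[ℂ] H) u‖ ^ 2 := by
  rw [mul_apply_eq_comp, ← inner_star_right, re_inner_self]

theorem mul_star_le_one {W : H →L[ℂ] H} (h : ∀ u, ‖(star W : H →L[ℂ] H) u‖ ^ 2 ≤ ‖u‖ ^ 2) :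
    W * star W ≤ 1 := by
  refine le_of_re_inner_le (IsSelfAdjoint.mul_star_self W) (IsSelfAdjoint.one _) fun u => ?_
  rw [re_inner_mul_star, one_apply_eq_self, re_inner_self]
  exact h u

namespace IsResolventPair

variable {E X W h : H →L[ℂ] H} (hp : IsResolventPair E X)

include hp

/-! ### The Friedrichs resolvent `W W*` -/

section Friedrichs

variable (hf : IsFactorization X W h) (hh : h * h = E * X)

include hf hh

theorem mul_star_le_one_of_factorization : W * star W ≤ 1 := by
  refine mul_star_le_one fun u => hf.norm_star_apply_sq_le fun v => ?_
  have h1 := hp.norm_sq_le v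
  rw [← hf.norm_sq_eq hh hp.proj] at h1
  have h2 := norm_sub_sq (𝕜 := ℂ) u (X v)
  rw [RCLike.re_eq_complex_re] at h2
  nlinarith [sq_nonneg ‖u - X v‖]

omit hh in
theorem star_apply_eq_zero (u : H) (hu : (star W : H →L[ℂ] H) u = 0) : u = 0 := by
  refine hp.ker_star u ?_
  rw [hf.eq_mul, star_mul, mul_apply_eq_comp, hu, map_zero]

omit hh in
theorem mul_star_apply_eq_zero (u : H) (hu : (W * star W) u = 0) : u = 0 := by
  refine hp.star_apply_eq_zero hf u (norm_eq_zero.1 (pow_eq_zero_iff two_ne_zero |>.1 ?_))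
  rw [← re_inner_mul_star, hu, inner_zero_left, Complex.zero_re]

theorem isPosSelfAdjointExt_friedrichs :
    IsPosSelfAdjointExt (quotient (E - X) X) (quotient (1 - W * star W) (W * star W)) :=
  hp.isPosSelfAdjointExt (mul_star_self_nonneg W) (hp.mul_star_le_one_of_factorization hf hh)
    (hp.mul_star_apply_eq_zero hf) (hf.mul_star_mul_proj hh hp.proj)

/-- Choose `h (v n) → W* u`. Then `X (v n) = W h (v n) → W W* u`, and this sequence is form-Cauchy
because `‖h v‖²` dominates the form at `X v`. -/
theorem mul_star_apply_mem_formDomain (u : H) :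
    (W * star W) u ∈ formDomain (quotient (E - X) X) hp.isPositive := by
  have hmem : (star W : H →L[ℂ] H) u ∈ closure (Set.range h) := hf.star_apply_mem_closure u
  obtain ⟨y, hy, hlim⟩ := mem_closure_iff_seq_limit.1 hmem
  choose v hv using hy
  have hlim' : Tendsto (fun n => h (v n)) atTop (𝓝 ((star W : H →L[ℂ] H) u)) := by
    simpa only [hv] using hlim
  choose w hw hw' using fun n => exists_domain_eq hp.ker_le_sub (v n)
  refine ⟨w, ?_, ?_⟩
  · have h1 := (W.continuous.tendsto _).comp hlim'
    refine h1.congr fun n => ?_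
    rw [hw, hf.eq_mul]
    rfl
  · have h1 : Tendsto (fun p : ℕ × ℕ => ‖h (v p.1) - h (v p.2)‖ ^ 2) atTop (𝓝 0) := by
      rw [← prod_atTop_atTop_eq]
      have h2 : Tendsto (fun p : ℕ × ℕ => h (v p.1) - h (v p.2)) (atTop ×ˢ atTop) _ :=
        (hlim'.comp tendsto_fst).sub (hlim'.comp tendsto_snd)
      simpa using h2.norm.pow 2
    refine squeeze_zero (fun p => (hp.isPositive _).1) (fun p => ?_) h1
    have e1 : ((w p.1 - w p.2 : (quotient (E - X) X).domain) : H) = X (v p.1 - v p.2) := by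
      rw [AddSubgroupClass.coe_sub, hw, hw, map_sub]
    have e2 : quotient (E - X) X (w p.1 - w p.2) = (E - X) (v p.1 - v p.2) := by
      rw [LinearPMap.map_sub, hw', hw', map_sub]
    rw [quadForm, e1, e2, ← map_sub, hf.norm_sq_eq hh hp.proj, sub_apply, inner_sub_left,
      Complex.sub_re, re_inner_self]
    linarith [sq_nonneg ‖X (v p.1 - v p.2)‖]

end Friedrichs

end IsResolventPair

/-- `dom S` is dense in the form domain for the form norm, so a vector of the form domain orthogonal
to `ran (S + I)` is form-orthogonal to everything. -/
theorem eq_zero_of_mem_formDomain {S : H →ₗ.[ℂ] H} (hS : IsPositive S) {y : H}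
    (hy : y ∈ formDomain S hS) (hort : ∀ x : S.domain, inner ℂ (S x + (x : H)) y = 0) :
    y = 0 := by
  obtain ⟨w, hw, hw'⟩ := hy
  have key : ∀ ε > 0, ‖y‖ ^ 2 ≤ ε := by
    intro ε hε
    obtain ⟨N, hN⟩ := eventually_atTop.1 (hw'.eventually (gt_mem_nhds hε))
    -- Expand the form norm of `w n - w m`, where the form itself is below `ε`, and drop nonnegative
    -- terms to bound `‖w m‖²`. As `m → ∞` the mixed term vanishes by `hort`.
    have hNn : ∀ n ≥ max N.1 N.2, ‖y‖ ^ 2 ≤ ε + ‖(w n : H) - y‖ ^ 2 := by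
      intro n hn
      have h1 : Tendsto (fun m => ε + ‖(w n : H) - w m‖ ^ 2
          + 2 * (inner ℂ (S (w n) + (w n : H)) (w m : H)).re) atTop
          (𝓝 (ε + ‖(w n : H) - y‖ ^ 2 + 2 * (inner ℂ (S (w n) + (w n : H)) y).re)) := by
        refine Tendsto.add (((tendsto_const_nhds.sub hw).norm.pow 2).const_add ε)
          (Tendsto.const_mul 2 ?_)
        exact (Complex.continuous_re.tendsto _).comp (tendsto_const_nhds.inner hw)
      rw [hort, Complex.zero_re, mul_zero, add_zero] at h1
      refine le_of_tendsto_of_tendsto (hw.norm.pow 2) h1 ?_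
      filter_upwards [eventually_ge_atTop (max N.1 N.2)] with m hm
      have h2 := hN (n, m) ⟨(le_max_left _ _).trans hn, (le_max_right _ _).trans hm⟩
      have h3 := (hS (w n)).1
      have h4 := (hS (w m)).1
      have h5 := congrArg Complex.re (hS.isFormalAdjoint (w m) (w n))
      rw [re_inner_symm (w m : H)] at h5
      have h6 := re_inner_symm (w m : H) (w n : H)
      simp only [quadForm, LinearPMap.map_sub, AddSubgroupClass.coe_sub, inner_sub_left,
        inner_sub_right, Complex.sub_re] at h2
      simp only [← re_inner_self, inner_sub_left, inner_sub_right, inner_add_left, Complex.sub_re,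
        Complex.add_re]
      nlinarith [sq_nonneg ‖(w n : H)‖, re_inner_self (w n : H)]
    have h1 : Tendsto (fun n => ε + ‖(w n : H) - y‖ ^ 2) atTop (𝓝 (ε + ‖y - y‖ ^ 2)) :=
      ((hw.sub_const y).norm.pow 2).const_add ε
    rw [sub_self, norm_zero, zero_pow two_ne_zero, add_zero] at h1
    exact ge_of_tendsto h1 (eventually_atTop.2 ⟨_, hNn⟩)
  exact norm_eq_zero.1 (pow_eq_zero_iff two_ne_zero |>.1
    (le_antisymm (le_of_forall_pos_le_add fun ε hε => by simpa using key ε hε) (sq_nonneg _)))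

/-- Symmetry of `T` makes it a formal adjoint of its restriction `S`. -/
theorem IsPositive.le_adjoint {S T : H →ₗ.[ℂ] H} (hT : IsPositive T) (h : S ≤ T)
    (hS : Dense (S.domain : Set H)) : T ≤ S.adjoint := by
  refine LinearPMap.IsFormalAdjoint.le_adjoint hS fun x y => ?_
  rw [h.2 (show (x : H) = (⟨x, h.1 x.2⟩ : T.domain) from rfl)]
  exact hT.isFormalAdjoint ⟨x, h.1 x.2⟩ y

namespace IsResolventPair

variable {E X W h : H →L[ℂ] H}

theorem friedrichsExt_eq (hp : IsResolventPair E X) (hf : IsFactorization X W h)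
    (hh : h * h = E * X) :
    friedrichsExt (quotient (E - X) X) = quotient (1 - W * star W) (W * star W) := by
  have hext := hp.isPosSelfAdjointExt_friedrichs hf hh
  have hk := ker_le_one_sub (hp.mul_star_apply_eq_zero hf)
  have hle := hext.2.2.le_adjoint hext.1 hp.dense
  rw [friedrichsExt, dif_pos hp.isPositive]
  refine le_antisymm (LinearPMap.le_of_le_graph fun p hg => ?_)
    (LinearPMap.le_of_le_graph fun p hg => ?_)
  · obtain ⟨x, hx1, hx2⟩ := (LinearPMap.mem_graph_iff _).1 hg
    obtain ⟨hxF, hxS⟩ := x.2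
    replace hx2 := (LinearPMap.domRestrict_apply (x := x)
      (y := (⟨x, hxS⟩ : (quotient (E - X) X).adjoint.domain)) rfl).symm.trans hx2
    -- Here `p.2 + p.1 = (S* + I) p.1`. The difference lies in the form domain and, since `W W* E =
    -- X`, is orthogonal to `ran (S + I)`.
    have hy : p.1 - (W * star W) (p.2 + p.1) = 0 := by
      refine eq_zero_of_mem_formDomain hp.isPositive
        (sub_mem (hx1 ▸ hxF) (hp.mul_star_apply_mem_formDomain hf hh _)) fun s => ?_
      have h1 := (LinearPMap.adjoint_isFormalAdjoint hp.dense).symm s ⟨x, hxS⟩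
      rw [hx2] at h1
      change inner ℂ _ (x : H) = _ at h1
      rw [hx1] at h1
      obtain ⟨v, hv, hv'⟩ := exists_apply_eq hp.ker_le_sub s
      have h2 : quotient (E - X) X s + s = E v := by
        rw [← hv, ← hv', sub_apply, sub_add_cancel]
      have h3 : inner ℂ (E v) ((W * star W) (p.2 + p.1)) = inner ℂ (s : H) (p.2 + p.1) := by
        have h4 := inner_star_left (W * star W) (E v) (p.2 + p.1)
        rw [(IsSelfAdjoint.mul_star_self W).star_eq] at h4
        rw [← h4, ← hv, ← hf.mul_star_mul_proj hh hp.proj]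
        rfl
      rw [inner_sub_right, h2, h3, ← h2, inner_add_left, inner_add_right, h1]
      ring
    rw [sub_eq_zero] at hy
    refine (mem_graph_quotient hk p).2 ⟨p.2 + p.1, hy.symm, ?_⟩
    rw [sub_apply, ← hy, one_apply_eq_self, add_sub_cancel_right]
  · obtain ⟨u, hu1, hu2⟩ := (mem_graph_quotient hk p).1 hg
    obtain ⟨x, hx1, hx2⟩ := (LinearPMap.mem_graph_iff _).1 (LinearPMap.le_graph_of_le hle hg)
    have hF : (x : H) ∈ formDomain (quotient (E - X) X) hp.isPositive := by
      rw [hx1, ← hu1]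
      exact hp.mul_star_apply_mem_formDomain hf hh u
    let z : ((quotient (E - X) X).adjoint.domRestrict
      (formDomain (quotient (E - X) X) hp.isPositive)).domain := ⟨x, hF, x.2⟩
    have hzx : (z : H) = x := rfl
    exact (LinearPMap.mem_graph_iff _).2 ⟨z, hx1, (LinearPMap.domRestrict_le.2 hzx).trans hx2⟩

/-- Minimality of `V V*`: if `T` has resolvent `Y` and `u = T x + x`, then `T x = (I - Y) u`, so the
bound says `V V* ≤ I - Y`. -/
theorem norm_star_apply_sq_le (hp : IsResolventPair E X) {V k : H →L[ℂ] H}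
    (hf : IsFactorization (E - X) V k) (hh : k * k = E * (E - X)) {T : H →ₗ.[ℂ] H}
    (hT : IsPositive T) (hle : quotient (E - X) X ≤ T) (x : T.domain) :
    ‖(star V : H →L[ℂ] H) (T x + x)‖ ^ 2 ≤ (inner ℂ (T x) (T x + x)).re := by
  refine hf.norm_star_apply_sq_le fun v => ?_
  obtain ⟨z, hz, hz'⟩ := exists_of_quotient_le hp.ker_le_sub hle v
  have h1 := (hT (x - z)).1
  -- Expanding this by symmetry of `T` gives exactly the required bound at `v`, because `(E - X) v =
  -- T z` and `E v = T z + z`.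
  have h2 : 0 ≤ (inner ℂ (T (x - z)) (T (x - z) + (x - z : T.domain))).re := by
    rw [inner_add_right, Complex.add_re, re_inner_self]
    positivity
  have h3 : E v = T z + z := by rw [hz, hz', sub_apply, sub_add_cancel]
  rw [hf.norm_sq_eq hh hp.proj, h3, ← hz']
  have h4 := congrArg Complex.re (hT.isFormalAdjoint x z)
  have h5 := re_inner_symm (T z) (x : H)
  have h6 := re_inner_symm (T z) (z : H)
  have h7 := re_inner_symm (T z) (T x)
  simp only [LinearPMap.map_sub, AddSubgroupClass.coe_sub, inner_sub_left, inner_sub_right,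
    inner_add_left, inner_add_right, Complex.sub_re, Complex.add_re] at h2 ⊢
  linarith

theorem isKreinVonNeumannExt (hp : IsResolventPair E X) (hf : IsFactorization X W h)
    (hh : h * h = E * X) {V k : H →L[ℂ] H} (hf' : IsFactorization (E - X) V k)
    (hh' : k * k = E * (E - X)) :
    (∀ x, (1 - V * star V) x = 0 → x = 0) ∧ IsKreinVonNeumannExt (quotient (E - X) X)
      (quotient (1 - (1 - V * star V)) (1 - V * star V)) := by
  have hF := hp.isPosSelfAdjointExt_friedrichs hf hh
  -- Minimality applied to the Friedrichs extension gives `W W* ≤ I - V V*`; injectivity of `I - V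
  -- V*` is inherited from `W*`.
  have hbound : ∀ u, ‖(star V : H →L[ℂ] H) u‖ ^ 2 ≤ ‖u‖ ^ 2 - ‖(star W : H →L[ℂ] H) u‖ ^ 2 := by
    intro u
    obtain ⟨x, hx, hx'⟩ := exists_domain_eq (ker_le_one_sub (hp.mul_star_apply_eq_zero hf)) u
    have h1 := hp.norm_star_apply_sq_le hf' hh' hF.2.2 hF.1 x
    have h2 : (1 - W * star W) u + (W * star W) u = u := by simp
    rw [hx, hx', h2, sub_apply, inner_sub_left, Complex.sub_re, re_inner_mul_star,
      one_apply_eq_self, re_inner_self] at h1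
    exact h1
  have hinj : ∀ x, (1 - V * star V) x = 0 → x = 0 := fun u hu => by
    refine hp.star_apply_eq_zero hf u (norm_eq_zero.1 (pow_eq_zero_iff two_ne_zero |>.1 ?_))
    have h1 : ‖u‖ ^ 2 = ‖(star V : H →L[ℂ] H) u‖ ^ 2 := by
      rw [sub_apply, sub_eq_zero, one_apply_eq_self] at hu
      rw [← re_inner_mul_star, ← hu, re_inner_self]
    exact le_antisymm (by linarith [hbound u]) (sq_nonneg _)
  have hV1 : V * star V ≤ 1 := mul_star_le_one fun u =>
    (hbound u).trans (sub_le_self _ (sq_nonneg _))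
  refine ⟨hinj, hp.isPosSelfAdjointExt (sub_nonneg.2 hV1)
    (sub_le_self _ (mul_star_self_nonneg V)) hinj ?_, ?_⟩
  · rw [sub_mul, one_mul, hf'.mul_star_mul_proj hh' hp.proj, sub_sub_cancel]
  -- Minimality applied to an arbitrary extension `T` bounds its resolvent by `I - V V*`.
  · intro T hT u x x' hx hx'
    have h1 := hp.norm_star_apply_sq_le hf' hh' hT.2.2 hT.1 x'
    obtain ⟨v, hv, hv'⟩ := exists_apply_eq (ker_le_one_sub hinj) x
    have hvu : v = u := by
      rw [← hx, ← hv, ← hv', sub_apply, one_apply_eq_self, sub_add_cancel]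
    have h2 : T x' = u - x' := eq_sub_of_add_eq hx'
    rw [hx', h2, inner_sub_left, Complex.sub_re, re_inner_self] at h1
    rw [← hv, hvu, sub_apply, inner_sub_right, one_apply_eq_self, Complex.sub_re, re_inner_self,
      re_inner_symm u ((V * star V) u), re_inner_mul_star, re_inner_symm u]
    linarith

end IsResolventPair

/-! ### Resolvent pairs of affiliated operators -/

/-- For `S = A/B` the range of `S + I` is `ran (A + B)`, which is invariant under the commutant;
hence its projection lies in `M`. -/
theorem exists_isResolventPair (M : VonNeumannAlgebra H) {S : H →ₗ.[ℂ] H} (hS : S ∈ affiliated M)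
    (hd : Dense (S.domain : Set H)) (hc : S.IsClosed) (hpos : IsPositive S) :
    ∃ E ∈ M, ∃ X ∈ M, IsResolventPair E X ∧ S = quotient (E - X) X := by
  obtain ⟨A, hA, B, hB, hk, rfl⟩ := hS
  set S := quotient A B with hSdef
  have hcl := hpos.isClosed_shiftRange hc
  have : CompleteSpace (shiftRange S) := hcl.completeSpace_coe
  set E := (shiftRange S).starProjection with hE
  have hEs : IsStarProjection E := isStarProjection_starProjection
  have hmem : ∀ y, y ∈ shiftRange S ↔ ∃ u, (A + B) u = y := by
    intro y
    rw [mem_shiftRange]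
    constructor
    · rintro ⟨x, rfl⟩
      obtain ⟨u, hu, hu'⟩ := exists_apply_eq hk x
      exact ⟨u, by rw [add_apply, hu, hu']⟩
    · rintro ⟨u, rfl⟩
      obtain ⟨x, hx, hx'⟩ := exists_domain_eq hk u
      exact ⟨x, by rw [hx, hx']; rfl⟩
  have hEM : E ∈ M := by
    rw [VonNeumannAlgebra.IsStarProjection.mem_iff hEs]
    intro y hy
    rw [hE, Submodule.range_starProjection, Module.End.mem_invtSubmodule]
    intro z hz
    obtain ⟨u, rfl⟩ := (hmem z).1 hz
    have h1 := congrArg (fun T : H →L[ℂ] H => T u)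
      (VonNeumannAlgebra.mem_commutant_iff.1 hy _ (add_mem hA hB))
    exact (hmem _).2 ⟨y u, h1⟩
  -- With `E = (A + B) C`, the vector `B C x` is the preimage of `E x` under `S + I`, so `X = B C`.
  obtain ⟨C, hC, hEC⟩ := exists_factor M hEM (add_mem hA hB) fun x =>
    (hmem _).1 ((shiftRange S).starProjection_apply_mem x)
  have hECx : ∀ x, A (C x) + B (C x) = E x := fun x =>
    (congrArg (fun T : H →L[ℂ] H => T x) hEC).symm
  have huniq : ∀ u v, A u + B u = A v + B v → B u = B v := by
    intro u v huv
    obtain ⟨x, hx, hx'⟩ := exists_domain_eq hk u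
    obtain ⟨y, hy, hy'⟩ := exists_domain_eq hk v
    rw [← hx, ← hy]
    exact congrArg _ (hpos.eq_of_add_eq (by rw [hx, hx', hy, hy', huv]))
  have hEE : ∀ x, E (E x) = E x := fun x =>
    congrArg (fun T : H →L[ℂ] H => T x) hEs.isIdempotentElem.eq
  have hEu : ∀ u, E (A u + B u) = A u + B u := fun u =>
    Submodule.starProjection_eq_self_iff.2 ((hmem _).2 ⟨u, rfl⟩)
  have hsub : E - B * C = A * C := by rw [hEC]; noncomm_ring
  have hBC : ∀ u, B (C (A u + B u)) = B u := fun u => huniq _ _ (by rw [hECx, hEu])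
  have hkX : ∀ x, (B * C) x = 0 → E x = 0 := fun x hx => by
    have hx' : B (C x) = 0 := hx
    rw [← hECx, hk _ hx', hx', add_zero]
  have hkX' : ∀ x, (B * C) x = 0 → (E - B * C) x = 0 := fun x hx => by
    rw [sub_apply, hkX x hx, hx, sub_zero]
  refine ⟨E, hEM, B * C, mul_mem hB hC, ⟨hEs, ?_, hkX, ?_, ?_⟩, ?_⟩
  · ext x
    exact huniq (C (E x)) (C x) (by rw [hECx, hECx, hEE])
  · have h0 : (0 : H →L[ℂ] H) ≤ E * (B * C) - star (B * C) * (B * C) := by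
      rw [ContinuousLinearMap.nonneg_iff_isPositive, ContinuousLinearMap.isPositive_iff_complex]
      intro v
      obtain ⟨x, hx, hx'⟩ := exists_domain_eq hk (C v)
      have h1 : inner ℂ (S x) (x : H) =
          inner ℂ v ((E * (B * C) - star (B * C) * (B * C)) v) := by
        rw [sub_apply, inner_sub_right, mul_apply_eq_comp, mul_apply_eq_comp (star (B * C)),
          inner_star_right, ← inner_star_left, hEs.isSelfAdjoint.star_eq, ← inner_sub_left,
          ← sub_apply, hsub]
        change inner ℂ (quotient A B x) (x : H) = _
        rw [hx, hx']
        rfl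
      have h2 := hpos x
      rw [h1] at h2
      generalize E * (B * C) - star (B * C) * (B * C) = D at h2
      rw [← inner_conj_symm, RCLike.re_eq_complex_re, Complex.conj_re, Complex.conj_eq_iff_im.2 h2.2]
      exact ⟨Complex.ext rfl h2.2.symm, h2.1⟩
    exact sub_nonneg.1 h0
  · intro x hx
    refine hd.eq_zero_of_inner_left ℂ fun y hy => ?_
    obtain ⟨u, hu, -⟩ := exists_apply_eq hk ⟨y, hy⟩
    change B u = y at hu
    rw [← hu, ← hBC]
    have := inner_star_left (B * C) x (A u + B u)
    rw [hx, inner_zero_left] at this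
    exact this.symm
  · refine LinearPMap.eq_of_eq_graph (SetLike.ext fun p => ?_)
    rw [mem_graph_quotient hkX', hSdef, mem_graph_quotient hk, hsub]
    constructor
    · rintro ⟨u, hu1, hu2⟩
      refine ⟨A u + B u, (hBC u).trans hu1, ?_⟩
      have h1 := hECx (A u + B u)
      rw [hEu, hBC] at h1
      exact (add_right_cancel h1).trans hu2
    · rintro ⟨u, hu1, hu2⟩
      exact ⟨C u, hu1, hu2⟩

/-! ### Transport along a normal homomorphism -/

section Map

variable {M : VonNeumannAlgebra H} {N : VonNeumannAlgebra K}
  {Φ : M.toStarSubalgebra →⋆ₐ[ℂ] N.toStarSubalgebra}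

theorem IsResolventPair.map (hΦ : IsNormalHom Φ) {E X : M.toStarSubalgebra}
    (hp : IsResolventPair (E : H →L[ℂ] H) X) :
    IsResolventPair (Φ E : K →L[ℂ] K) (Φ X) where
  proj := by
    have h1 : E * E = E := Subtype.ext hp.proj.isIdempotentElem.eq
    have h2 : star E = E := Subtype.ext hp.proj.isSelfAdjoint.star_eq
    refine ⟨congrArg Subtype.val (?_ : Φ E * Φ E = Φ E),
      congrArg Subtype.val (?_ : star (Φ E) = Φ E)⟩
    · rw [← map_mul, h1]
    · rw [← map_star, h2]
  mul_proj := by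
    have h1 : X * E = X := Subtype.ext hp.mul_proj
    exact congrArg Subtype.val (show Φ X * Φ E = Φ X by rw [← map_mul, h1])
  ker_le := hΦ.null_le hp.ker_le
  star_mul_le := by
    -- Writing the positive difference as `c* c` with `c ∈ M` makes the inequality algebraic, hence
    -- preserved.
    obtain ⟨c, hc, hcs, hcc⟩ := exists_nonneg_mul_self_eq M
      (sub_mem (mul_mem E.2 X.2) (mul_mem (star_mem X.2) X.2)) (sub_nonneg.2 hp.star_mul_le)
    let c' : M.toStarSubalgebra := ⟨c, hc⟩
    have h1 : star c' * c' = E * X - star X * X := Subtype.ext (by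
      change star c * c = _
      rw [hcs.star_eq, hcc]
      rfl)
    have h2 : star (Φ c') * Φ c' = Φ E * Φ X - star (Φ X) * Φ X := by
      rw [← map_star, ← map_star, ← map_mul, ← map_mul, ← map_mul, ← map_sub, h1]
    have h3 : star (Φ c' : K →L[ℂ] K) * (Φ c' : K →L[ℂ] K) =
        (Φ E : K →L[ℂ] K) * (Φ X : K →L[ℂ] K) - star (Φ X : K →L[ℂ] K) * (Φ X : K →L[ℂ] K) :=
      congrArg Subtype.val h2
    rw [← sub_nonneg, ← h3]
    exact star_mul_self_nonneg _
  ker_star := by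
    intro x hx
    -- Injectivity of `X*` is a nullspace inclusion into that of the identity; `Φ` is unital.
    have h1 := hΦ.null_le (A := 1) (B := star X) hp.ker_star x (by
      rw [map_star]
      exact hx)
    rw [map_one] at h1
    exact h1

theorem IsFactorization.map (hΦ : IsNormalHom Φ) {A W h : M.toStarSubalgebra}
    (hf : IsFactorization (A : H →L[ℂ] H) W h) :
    IsFactorization (Φ A : K →L[ℂ] K) (Φ W) (Φ h) where
  isSelfAdjoint := by
    have h1 : star h = h := Subtype.ext hf.isSelfAdjoint
    exact congrArg Subtype.val (show star (Φ h) = Φ h by rw [← map_star, h1])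
  eq_mul := by
    have h1 : A = W * h := Subtype.ext hf.eq_mul
    exact congrArg Subtype.val (show Φ A = Φ W * Φ h by rw [← map_mul, ← h1])
  ker_le := hΦ.null_le hf.ker_le

end Map

end AffiliatedOperators

/-! ### The main theorem -/

theorem mainTheorem9 {H : Type*} [NormedAddCommGroup H] [InnerProductSpace ℂ H] [CompleteSpace H]
    {K : Type*} [NormedAddCommGroup K] [InnerProductSpace ℂ K] [CompleteSpace K]
    (M : VonNeumannAlgebra H) (N : VonNeumannAlgebra K)
    (Φ : M.toStarSubalgebra →⋆ₐ[ℂ] N.toStarSubalgebra)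
    (hΦ : AffiliatedOperators.IsNormalHom Φ)
    (S : H →ₗ.[ℂ] H) (hSM : S ∈ AffiliatedOperators.affiliated M)
    (hSdense : Dense (S.domain : Set H)) (hSclosed : S.IsClosed)
    (hSpos : AffiliatedOperators.IsPositive S) :
    -- `Φ_aff(S)` is a densely-defined closed positive operator in `N_aff`
    (AffiliatedOperators.affMap Φ S ∈ AffiliatedOperators.affiliated N ∧
      Dense ((AffiliatedOperators.affMap Φ S).domain : Set K) ∧
      (AffiliatedOperators.affMap Φ S).IsClosed ∧
      AffiliatedOperators.IsPositive (AffiliatedOperators.affMap Φ S)) ∧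
    -- the Krein-von Neumann extensions exist, the one of `S` is in `M_aff`, and `Φ_aff` maps
    -- it to the one of `Φ_aff(S)`
    (AffiliatedOperators.IsKreinVonNeumannExt S (AffiliatedOperators.kreinVonNeumannExt S) ∧
      AffiliatedOperators.IsKreinVonNeumannExt (AffiliatedOperators.affMap Φ S)
        (AffiliatedOperators.kreinVonNeumannExt (AffiliatedOperators.affMap Φ S)) ∧
      AffiliatedOperators.kreinVonNeumannExt S ∈ AffiliatedOperators.affiliated M ∧
      AffiliatedOperators.affMap Φ (AffiliatedOperators.kreinVonNeumannExt S) =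
        AffiliatedOperators.kreinVonNeumannExt (AffiliatedOperators.affMap Φ S)) ∧
    -- the same for the Friedrichs extensions
    (AffiliatedOperators.IsPosSelfAdjointExt S (AffiliatedOperators.friedrichsExt S) ∧
      AffiliatedOperators.IsPosSelfAdjointExt (AffiliatedOperators.affMap Φ S)
        (AffiliatedOperators.friedrichsExt (AffiliatedOperators.affMap Φ S)) ∧
      AffiliatedOperators.friedrichsExt S ∈ AffiliatedOperators.affiliated M ∧
      AffiliatedOperators.affMap Φ (AffiliatedOperators.friedrichsExt S) =
        AffiliatedOperators.friedrichsExt (AffiliatedOperators.affMap Φ S)) := by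
  obtain ⟨E₀, hE, X₀, hX, hp, rfl⟩ :=
    AffiliatedOperators.exists_isResolventPair M hSM hSdense hSclosed hSpos
  obtain ⟨W₀, hW, h₀, hhM, hf, hh⟩ :=
    AffiliatedOperators.exists_isFactorization M hX (mul_mem hE hX) hp.star_mul_le
  obtain ⟨V₀, hV, k₀, hkM, hg, hkk⟩ := AffiliatedOperators.exists_isFactorization M
    (sub_mem hE hX) (mul_mem hE (sub_mem hE hX)) hp.star_sub_mul_sub_le
  let E : M.toStarSubalgebra := ⟨E₀, hE⟩
  let X : M.toStarSubalgebra := ⟨X₀, hX⟩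
  let h : M.toStarSubalgebra := ⟨h₀, hhM⟩
  let k : M.toStarSubalgebra := ⟨k₀, hkM⟩
  let W : M.toStarSubalgebra := ⟨W₀, hW⟩
  let V : M.toStarSubalgebra := ⟨V₀, hV⟩
  have hpΦ := hp.map (E := E) (X := X) hΦ
  have hfΦ := hf.map (A := X) (W := W) (h := h) hΦ
  have hgΦ := hg.map (A := E - X) (W := V) (h := k) hΦ
  have hhΦ : (Φ h : K →L[ℂ] K) * Φ h = Φ E * Φ X := by
    have e : h * h = E * X := Subtype.ext hh
    exact congrArg Subtype.val (show Φ h * Φ h = Φ E * Φ X by rw [← map_mul, e, map_mul])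
  have hkΦ : (Φ k : K →L[ℂ] K) * Φ k = Φ E * (Φ E - Φ X) := by
    have e : k * k = E * (E - X) := Subtype.ext hkk
    exact congrArg Subtype.val
      (show Φ k * Φ k = Φ E * (Φ E - Φ X) by rw [← map_mul, e, map_mul, map_sub])
  rw [map_sub] at hgΦ
  have hSΦ : AffiliatedOperators.affMap Φ (AffiliatedOperators.quotient (E₀ - X₀) X₀) =
      AffiliatedOperators.quotient ((Φ E : K →L[ℂ] K) - (Φ X : K →L[ℂ] K)) (Φ X) := by
    have e := AffiliatedOperators.affMap_quotient (A := E - X) (B := X) hΦ hp.ker_le_sub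
    rw [map_sub] at e
    exact e
  obtain ⟨hinj, hK⟩ := hp.isKreinVonNeumannExt hf hh hg hkk
  obtain ⟨-, hKΦ⟩ := hpΦ.isKreinVonNeumannExt hfΦ hhΦ hgΦ hkΦ
  have hVΦ : AffiliatedOperators.affMap Φ
        (AffiliatedOperators.quotient (1 - (1 - V₀ * star V₀)) (1 - V₀ * star V₀)) =
      AffiliatedOperators.quotient (1 - (1 - (Φ V : K →L[ℂ] K) * star (Φ V : K →L[ℂ] K)))
        (1 - (Φ V : K →L[ℂ] K) * star (Φ V : K →L[ℂ] K)) := by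
    have e := AffiliatedOperators.affMap_quotient (A := 1 - (1 - V * star V))
      (B := 1 - V * star V) hΦ (AffiliatedOperators.ker_le_one_sub hinj)
    simp only [map_sub, map_one, map_mul, map_star] at e
    exact e
  have hWΦ : AffiliatedOperators.affMap Φ
        (AffiliatedOperators.quotient (1 - W₀ * star W₀) (W₀ * star W₀)) =
      AffiliatedOperators.quotient (1 - (Φ W : K →L[ℂ] K) * star (Φ W : K →L[ℂ] K))
        ((Φ W : K →L[ℂ] K) * star (Φ W : K →L[ℂ] K)) := by
    have e := AffiliatedOperators.affMap_quotient (A := 1 - W * star W) (B := W * star W) hΦ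
      (AffiliatedOperators.ker_le_one_sub (hp.mul_star_apply_eq_zero hf))
    simp only [map_sub, map_one, map_mul, map_star] at e
    exact e
  -- The construction on `K`, run with the image data, gives the same expressions in `Φ V` and `Φ
  -- W`; all extensions thus become explicit quotients.
  rw [← hK.eq_kreinVonNeumannExt, hp.friedrichsExt_eq hf hh, hSΦ, ← hKΦ.eq_kreinVonNeumannExt,
    hpΦ.friedrichsExt_eq hfΦ hhΦ]
  refine ⟨⟨?_, hpΦ.dense, hpΦ.isClosed, hpΦ.isPositive⟩, ⟨hK, hKΦ, ?_, hVΦ⟩,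
    ⟨hp.isPosSelfAdjointExt_friedrichs hf hh, hpΦ.isPosSelfAdjointExt_friedrichs hfΦ hhΦ, ?_, hWΦ⟩⟩
  · rw [← hSΦ]
    exact AffiliatedOperators.affMap_mem_affiliated hΦ hSM
  · have h1 : 1 - V₀ * star V₀ ∈ M := sub_mem (one_mem M) (mul_mem hV (star_mem hV))
    exact ⟨_, sub_mem (one_mem M) h1, _, h1, AffiliatedOperators.ker_le_one_sub hinj, rfl⟩
  · have h1 : W₀ * star W₀ ∈ M := mul_mem hW (star_mem hW)
    exact ⟨_, sub_mem (one_mem M) h1, _, h1,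
      AffiliatedOperators.ker_le_one_sub (hp.mul_star_apply_eq_zero hf), rfl⟩
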